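/- **Setting.** Pseudodiagrams are oriented planar link diagrams, considered on the sphere, in which some crossings (precrossings) carry no over/under information. Pseudolinks are their classes under planar isotopy, the oriented Reidemeister moves R1, R2, R3 and the pseudo-moves PR1 (a precrossing at a curl is removed), PR2 (a precrossing and a classical crossing on a common bigon change places) and PR3 (a strand that runs entirely over or entirely under moves past a precrossing). Let $J(L)=(-A^3)^{-w(L)}\langle L\rangle\in\mathbb Z[A^{\pm1}]$ be the Jones polynomial of an oriented link diagram, where $w$ is the writhe and $\langle\cdot\rangle$ the Kauffman bracket with $\langle O\rangle=1$, and let $\delta=-A^2-A^{-2}$. For a function $I$ of oriented link diagrams with values in a commutative ring $R$, and a pseudodiagram $P$ with $k$ precrossings, let $P_0$ be the link diagram obtained by inserting the $0$-tangle (the smoothing that respects the orientation) at every precrossing. The tangle insertion invariant of $I$ with the $0$-tangle as the only tangle is $$\overline{I}(P)=X^k\,I(P_0)\in R[X]/\langle X\, I(O\sqcup O)-1\rangle,$$ where $O\sqcup O$, two disjoint circles, is the denominator closure of the $0$-tangle. For $I=J$ one has $J(O\sqcup O)=\delta$, so $X=1/\delta$. A planar diagram code $[a,b,c,d]$ lists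 the arcs around a crossing counterclockwise, beginning with the incoming arc of the under-strand. Let $B$ be the pseudo-Borromean diagram: the Borromean rings with code $[6,1,7,2]\,[12,8,9,7]\,[4,12,1,11]\,[10,5,11,6]\,[8,4,5,3]\,[2,9,3,10]$ and components oriented as $1\to2\to3\to4\to1$, $5\to6\to7\to8\to5$, $9\to10\to11\to12\to9$, where the first crossing (a negative one) has been turned into a precrossing. Let $\mathrm{Wh}$ be the Whitehead link with code $[1,7,2,6]\,[7,5,8,10]\,[5,1,6,4]\,[9,2,10,3]\,[3,8,4,9]$ and components $1\to2\to3\to4\to1$, $5\to6\to\dots\to10\to5$. **Statement.** Both diagrams are planar, and inserting the $0$-tangle at the precrossing of $B$ gives, up to planar isotopy, the diagram $\mathrm{Wh}$. Its Jones polynomial is $$J(\mathrm{Wh})=V:=-A^6+A^2-2A^{-2}+A^{-6}-2A^{-10}+A^{-14},$$ and $\overline{J}(B)=X\,V=V/\delta$, where $J(O\sqcup O)=\delta$. The value $\overline{J}$ is an invariant of oriented pseudolinks; $\overline{J}(B)\neq\overline{J}(U)$ for every diagram $U$ without crossings and precrossings, and therefore $B$ represents a nontrivial pseudolink, that is, $B$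 is not equivalent to any such $U$. A linking number does not detect this: $\mathrm{Wh}$ has two components, their linking number is $0$, and for the invariant $I(L)=q^{\mathrm{lk}(L)}\in\mathbb Z[q^{\pm1/2}]$, where $\mathrm{lk}$ is the total linking number (half the sum of the signs of the crossings between different components), one has $\overline{I}(B)=\overline{I}(U)$ for every diagram $U$ without crossings and precrossings. -/

import Mathlib

open scoped LaurentPolynomial

/-! Oriented planar diagrams as combinatorial maps.

Every crossing is drawn with both strands running upwards.  It then has two incoming ends (bottom
left, bottom right) and two outgoing ends (top left, top right), and the two strands run from bottom
left to top right and from bottom right to top left.  A side is a `Bool`: `false` is left, `true` is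
right.  Besides crossings there are two-valent points, which lie on strands (or on circles without
crossings) and carry no information.  An arc runs from an outgoing end (or a point) to an incoming
end (or a point), and is named by the place where it starts. -/

/-- An oriented diagram whose crossings carry labels in `κ`; `next` sends the start of each arc to
its end. -/
structure OrientedDiagram (κ : Type) where
  V : Type
  W : Type
  [fintypeV : Fintype V]
  [fintypeW : Fintype W]
  label : V → κ
  next : (V × Bool) ⊕ W ≃ (V × Bool) ⊕ W

attribute [instance] OrientedDiagram.fintypeV OrientedDiagram.fintypeW

/-- The sign of a classical crossing.  At a positive crossing the strand from bottom left to top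
right is the over-strand; at a negative crossing it is the under-strand. -/
inductive CrossingSign where
  | pos
  | neg

def CrossingSign.toInt : CrossingSign → ℤ
  | .pos => 1
  | .neg => -1

/-- Diagrams of oriented links. -/
abbrev LinkDiagram := OrientedDiagram CrossingSign

/-- Oriented pseudodiagrams; the label `none` is a precrossing. -/
abbrev PseudoDiagram := OrientedDiagram (Option CrossingSign)

namespace OrientedDiagram

variable {κ : Type}

/-- The arcs of a diagram (named by their starting places). -/
abbrev Arc (D : OrientedDiagram κ) : Type := (D.V × Bool) ⊕ D.W

/-- The arc that leaves the crossing `v` on side `s`. -/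
def outArc (D : OrientedDiagram κ) (v : D.V) (s : Bool) : D.Arc := Sum.inl (v, s)

/-- The arc that enters the crossing `v` on side `s`. -/
def inArc (D : OrientedDiagram κ) (v : D.V) (s : Bool) : D.Arc := D.next.symm (Sum.inl (v, s))

/-- The arc that ends at the point `w`. -/
def inPoint (D : OrientedDiagram κ) (w : D.W) : D.Arc := D.next.symm (Sum.inr w)

/-- The arc that starts at the point `w`. -/
def outPoint (D : OrientedDiagram κ) (w : D.W) : D.Arc := Sum.inr w

/-! Planarity: Euler's formula for every connected piece of the diagram. -/

/-- Two sides of arcs that meet at a corner of a crossing, or along a strand at a point. -/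
inductive SameFace (D : OrientedDiagram κ) : D.Arc × Bool → D.Arc × Bool → Prop where
  | left (v : D.V) : SameFace D (D.inArc v false, false) (D.outArc v false, false)
  | right (v : D.V) : SameFace D (D.inArc v true, true) (D.outArc v true, true)
  | top (v : D.V) : SameFace D (D.outArc v false, true) (D.outArc v true, false)
  | bottom (v : D.V) : SameFace D (D.inArc v false, true) (D.inArc v true, false)
  | point (w : D.W) (s : Bool) : SameFace D (D.inPoint w, s) (D.outPoint w, s)

/-- Two arcs with a common crossing or point. -/
inductive Adjacent (D : OrientedDiagram κ) : D.Arc → D.Arc → Prop where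
  | side (v : D.V) (s : Bool) : Adjacent D (D.inArc v s) (D.outArc v s)
  | bottom (v : D.V) : Adjacent D (D.inArc v false) (D.inArc v true)
  | point (w : D.W) : Adjacent D (D.inPoint w) (D.outPoint w)

/-- The diagram has genus zero.  Since the number of arcs is `2 * #V + #W`, this is
`(#V + #W) - #arcs + #faces = 2 * #pieces`. -/
def IsPlanar (D : OrientedDiagram κ) : Prop :=
  Nat.card (Quot D.SameFace) = Fintype.card D.V + 2 * Nat.card (Quot D.Adjacent)

/-! Planar isotopy: relabelling, and insertion or deletion of points. -/

/-- An orientation-preserving isomorphism of diagrams. -/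
structure Iso (D D' : OrientedDiagram κ) where
  v : D.V ≃ D'.V
  w : D.W ≃ D'.W
  label_eq : ∀ x, D'.label (v x) = D.label x
  next_eq : ∀ a, D'.next (Sum.map (Prod.map v id) w a) = Sum.map (Prod.map v id) w (D.next a)

open Classical in
/-- Put a new point on the arc `a`. -/
noncomputable def subdivide (D : OrientedDiagram κ) (a : D.Arc) : OrientedDiagram κ where
  V := D.V
  W := D.W ⊕ Unit
  label := D.label
  next := (Equiv.sumAssoc (D.V × Bool) D.W Unit).symm.trans
    (((Equiv.swap (Sum.inl a) (Sum.inr ())).trans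
      (Equiv.sumCongr D.next (Equiv.refl Unit))).trans
      (Equiv.sumAssoc (D.V × Bool) D.W Unit))

inductive IsotopyStep : OrientedDiagram κ → OrientedDiagram κ → Prop where
  | iso {D D' : OrientedDiagram κ} (e : D.Iso D') : IsotopyStep D D'
  | subdivide (D : OrientedDiagram κ) (a : D.Arc) : IsotopyStep D (D.subdivide a)

/-- Diagrams of the same shape, up to points on their strands. -/
def PlanarIsotopic : OrientedDiagram κ → OrientedDiagram κ → Prop :=
  Relation.EqvGen IsotopyStep

/-! Link components and linking numbers. -/

/-- Consecutive arcs of one strand. -/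
inductive SameStrand (D : OrientedDiagram κ) : D.Arc → D.Arc → Prop where
  | crossing (v : D.V) (s : Bool) : SameStrand D (D.inArc v s) (D.outArc v (!s))
  | point (w : D.W) : SameStrand D (D.inPoint w) (D.outPoint w)

/-- The components of the link. -/
def Component (D : OrientedDiagram κ) : Type := Quot D.SameStrand

/-- The component that leaves the crossing `v` on side `s`. -/
def strandAt (D : OrientedDiagram κ) (v : D.V) (s : Bool) : D.Component :=
  Quot.mk _ (D.outArc v s)

/-- A closed diagram from its Gauss code.  The link is cut at its passages through crossings,
numbered by `Fin m`: passage `p` enters the crossing `(visit p).1` on side `(visit p).2` (and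
leaves it on the other side), and is followed by the passage `succ p`. -/
def ofGauss {n m : ℕ} (label : Fin n → κ) (visit : Fin m ≃ Fin n × Bool)
    (succ : Equiv.Perm (Fin m)) : OrientedDiagram κ where
  V := Fin n
  W := Empty
  label := label
  next := Equiv.sumCongr
    ((((Equiv.refl (Fin n)).prodCongr Equiv.boolNot).trans visit.symm).trans (succ.trans visit))
    (Equiv.refl Empty)

end OrientedDiagram

/-! Kauffman bracket and Jones polynomial of a link diagram. -/

namespace LinkDiagram

/-- The sum of the signs of all crossings. -/
def writhe (D : LinkDiagram) : ℤ := ∑ v, (D.label v).toInt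

/-- A state `σ` smooths every crossing: `σ v = true` is the smoothing that respects the
orientation (bottom left to top left, bottom right to top right), `σ v = false` is the other one
(the two bottom ends together, the two top ends together).  The relation links consecutive arcs of
the resulting curves. -/
inductive StateStep (D : LinkDiagram) (σ : D.V → Bool) : D.Arc → D.Arc → Prop where
  | oriented (v : D.V) (s : Bool) (h : σ v = true) : StateStep D σ (D.inArc v s) (D.outArc v s)
  | bottom (v : D.V) (h : σ v = false) : StateStep D σ (D.inArc v false) (D.inArc v true)
  | top (v : D.V) (h : σ v = false) : StateStep D σ (D.outArc v false) (D.outArc v true)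
  | point (w : D.W) : StateStep D σ (D.inPoint w) (D.outPoint w)

/-- The number of closed curves in a state. -/
noncomputable def loops (D : LinkDiagram) (σ : D.V → Bool) : ℕ := Nat.card (Quot (D.StateStep σ))

/-- The smoothing that respects the orientation is the `A`-smoothing exactly at positive
crossings. -/
def stateExponent (D : LinkDiagram) (σ : D.V → Bool) : ℤ :=
  ∑ v, if σ v = true then (D.label v).toInt else -(D.label v).toInt

/-- `δ = - A ^ 2 - A ^ (-2)`; the variable `A` is `LaurentPolynomial.T 1`. -/
noncomputable def delta : ℤ[T;T⁻¹] := -LaurentPolynomial.T 2 - LaurentPolynomial.T (-2)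

open Classical in
/-- The Kauffman bracket, with value `1` on a circle. -/
noncomputable def bracket (D : LinkDiagram) : ℤ[T;T⁻¹] :=
  ∑ σ : D.V → Bool, LaurentPolynomial.T (D.stateExponent σ) * delta ^ (D.loops σ - 1)

/-- The Jones polynomial `(- A ^ 3) ^ (- writhe) * bracket`. -/
noncomputable def jones (D : LinkDiagram) : ℤ[T;T⁻¹] :=
  (Int.negOnePow D.writhe : ℤ) • (LaurentPolynomial.T (-3 * D.writhe) * D.bracket)

open Classical in
/-- The linking number of two different components: half the sum of the signs of the crossings
between them. -/
noncomputable def linkingNumber (D : LinkDiagram) (i j : D.Component) : ℚ :=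
  (1 / 2) * ∑ v, if (D.strandAt v false = i ∧ D.strandAt v true = j) ∨
    (D.strandAt v false = j ∧ D.strandAt v true = i) then ((D.label v).toInt : ℚ) else 0

open Classical in
/-- The sum of the signs of all crossings between different components, that is, twice the total
linking number. -/
noncomputable def mixedWrithe (D : LinkDiagram) : ℤ :=
  ∑ v, if D.strandAt v false = D.strandAt v true then 0 else (D.label v).toInt

/-- The total linking number `lk` written multiplicatively, as `q ^ lk` with `q = T 2`, so that
connected sums go to products. -/
noncomputable def linkingInvariant (D : LinkDiagram) : ℤ[T;T⁻¹] :=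
  LaurentPolynomial.T D.mixedWrithe

/-- Two disjoint circles without crossings: the denominator closure of the `0`-tangle. -/
def twoCircles : LinkDiagram where
  V := Empty
  W := Bool
  label := Empty.elim
  next := Equiv.refl _

end LinkDiagram

/-! Local changes of diagrams. -/

/-- The part of an oriented diagram inside a disc, with inputs `ι` and outputs `ι` on the boundary.
`wiring` sends the starts of arcs (outgoing ends, inputs) to their ends (incoming ends, outputs). -/
structure LocalTangle (κ ι : Type) where
  V : Type
  [fintypeV : Fintype V]
  label : V → κ
  wiring : (V × Bool) ⊕ ι ≃ (V × Bool) ⊕ ι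

/-- The part of a diagram outside a disc: here arcs start at outputs of the disc and end at its
inputs. -/
structure Exterior (κ ι : Type) where
  V : Type
  W : Type
  [fintypeV : Fintype V]
  [fintypeW : Fintype W]
  label : V → κ
  wiring : ((V × Bool) ⊕ W) ⊕ ι ≃ ((V × Bool) ⊕ W) ⊕ ι

attribute [instance] LocalTangle.fintypeV Exterior.fintypeV Exterior.fintypeW

namespace Exterior

/-- Sorts the starts of arcs into those outside and those inside the disc.  In `ι ⊕ ι` the left
summand holds the inputs and the right one the outputs. -/
def sortStarts (V V' W ι : Type) :
    ((V ⊕ V') × Bool) ⊕ (W ⊕ (ι ⊕ ι)) ≃ (((V × Bool) ⊕ W) ⊕ ι) ⊕ ((V' × Bool) ⊕ ι) where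
  toFun
    | Sum.inl (Sum.inl v, s) => Sum.inl (Sum.inl (Sum.inl (v, s)))
    | Sum.inl (Sum.inr v, s) => Sum.inr (Sum.inl (v, s))
    | Sum.inr (Sum.inl w) => Sum.inl (Sum.inl (Sum.inr w))
    | Sum.inr (Sum.inr (Sum.inl i)) => Sum.inr (Sum.inr i)
    | Sum.inr (Sum.inr (Sum.inr i)) => Sum.inl (Sum.inr i)
  invFun
    | Sum.inl (Sum.inl (Sum.inl (v, s))) => Sum.inl (Sum.inl v, s)
    | Sum.inr (Sum.inl (v, s)) => Sum.inl (Sum.inr v, s)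
    | Sum.inl (Sum.inl (Sum.inr w)) => Sum.inr (Sum.inl w)
    | Sum.inr (Sum.inr i) => Sum.inr (Sum.inr (Sum.inl i))
    | Sum.inl (Sum.inr i) => Sum.inr (Sum.inr (Sum.inr i))
  left_inv := by rintro (⟨_ | _, _⟩ | (_ | (_ | _))) <;> rfl
  right_inv := by rintro (((⟨_, _⟩ | _) | _) | (⟨_, _⟩ | _)) <;> rfl

/-- The same for the ends of arcs: an arc that ends at an input lies outside. -/
def sortEnds (V V' W ι : Type) :
    ((V ⊕ V') × Bool) ⊕ (W ⊕ (ι ⊕ ι)) ≃ (((V × Bool) ⊕ W) ⊕ ι) ⊕ ((V' × Bool) ⊕ ι) :=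
  (Equiv.sumCongr (Equiv.refl _) (Equiv.sumCongr (Equiv.refl _) (Equiv.sumComm ι ι))).trans
    (sortStarts V V' W ι)

/-- The diagram with the tangle `t` in the disc; inputs and outputs become points. -/
def fill {κ ι : Type} [Fintype ι] (E : Exterior κ ι) (t : LocalTangle κ ι) :
    OrientedDiagram κ where
  V := E.V ⊕ t.V
  W := E.W ⊕ (ι ⊕ ι)
  label := Sum.elim E.label t.label
  next := (sortStarts E.V t.V E.W ι).trans
    ((Equiv.sumCongr E.wiring t.wiring).trans (sortEnds E.V t.V E.W ι).symm)

end Exterior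

namespace LocalTangle

variable {κ : Type}

/-- Strands without crossings. -/
def trivial (κ ι : Type) : LocalTangle κ ι where
  V := Empty
  label := Empty.elim
  wiring := Equiv.refl _

/-- The tangle in which each strand passes exactly two crossings: the passages of strand `i` are
`(i, false)` and then `(i, true)`; passage `p` enters the crossing `(visit p).1` on side
`(visit p).2` and leaves it on the other side. -/
def ofVisits {ι C : Type} [Fintype C] (label : C → κ) (visit : ι × Bool ≃ C × Bool) :
    LocalTangle κ ι where
  V := C
  label := label
  wiring :=
    { toFun := fun
        | Sum.inr i => Sum.inl (visit (i, false))
        | Sum.inl (c, s) =>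
          match visit.symm (c, !s) with
          | (i, false) => Sum.inl (visit (i, true))
          | (i, true) => Sum.inr i
      invFun := fun
        | Sum.inr i => Sum.inl ((visit (i, true)).1, !(visit (i, true)).2)
        | Sum.inl (c, s) =>
          match visit.symm (c, s) with
          | (i, false) => Sum.inr i
          | (i, true) => Sum.inl ((visit (i, false)).1, !(visit (i, false)).2)
      left_inv := by
        rintro (⟨c, s⟩ | i)
        · rcases h : visit.symm (c, !s) with ⟨i, _ | _⟩ <;>
            simp [h, ← (Equiv.symm_apply_eq visit).mp h]
        · simp
      right_inv := by
        rintro (⟨c, s⟩ | i)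
        · rcases h : visit.symm (c, s) with ⟨i, _ | _⟩ <;>
            simp [h, ← (Equiv.symm_apply_eq visit).mp h]
        · simp }

/-- A curl: the strand enters the crossing on side `s` and comes back on the other side. -/
def curl (s : Bool) (k : κ) : LocalTangle κ Unit :=
  ofVisits (C := Unit) (fun _ => k)
    { toFun := fun p => ((), xor s p.2)
      invFun := fun q => ((), xor s q.2)
      left_inv := by revert s; decide
      right_inv := by revert s; decide }

/-- Two parallel strands that cross twice and bound a bigon.  Crossing `false` (label `k`) is the
lower one, crossing `true` (label `l`) the upper one; strand `false` starts on the left. -/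
def parallelBigon (k l : κ) : LocalTangle κ Bool :=
  ofVisits (C := Bool) (fun c => if c then l else k)
    { toFun := fun p => (p.2, xor p.1 p.2)
      invFun := fun q => (xor q.1 q.2, q.1)
      left_inv := by decide
      right_inv := by decide }

/-- Two antiparallel strands that cross twice and bound a bigon, which lies on the left of both
(`s = false`) or on the right of both (`s = true`).  Strand `false` passes the crossing `false`
(label `k`) and then the crossing `true` (label `l`); strand `true` passes them in the opposite
order. -/
def antiparallelBigon (s : Bool) (k l : κ) : LocalTangle κ Bool :=
  ofVisits (C := Bool) (fun c => if c then l else k)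
    { toFun := fun p => (xor p.1 p.2, xor (!s) p.2)
      invFun := fun q => (xor q.1 (xor (!s) q.2), xor (!s) q.2)
      left_inv := by revert s; decide
      right_inv := by revert s; decide }

/-- Three strands, any two of which cross once, around a triangle; the crossing `i` is that of the
strands `i` and `i + 1`.  For `f = fun _ => false`, `m = false` the triangle lies on the left of all
strands and its boundary passes the crossings in the order `0, 1, 2`.  `f i = true` means that the
direction of the strand `i` is reversed, and `m = true` that each strand has been pushed across the
crossing of the two others (each strand passes its crossings in the opposite order). -/
def triangle (f : Fin 3 → Bool) (m : Bool) (label : Fin 3 → κ) : LocalTangle κ (Fin 3) :=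
  ofVisits (C := Fin 3) label
    { toFun := fun p =>
        if xor (f p.1) (xor m p.2) then (p.1, xor (f p.1) (f (p.1 + 1)))
        else (p.1 + 2, !(xor (f (p.1 + 2)) (f p.1)))
      invFun := fun q =>
        if q.2 = xor (f q.1) (f (q.1 + 1)) then (q.1, !(xor (f q.1) m))
        else (q.1 + 1, xor (f (q.1 + 1)) m)
      left_inv := by revert f m; decide
      right_inv := by revert f m; decide }

/-- The sign of the crossing `i` in a triangle with directions `f` if the strand `i` runs over
(`o i = true`) or under (`o i = false`) the strand `i + 1`. -/
def triangleSign (f o : Fin 3 → Bool) (i : Fin 3) : CrossingSign :=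
  if o i = (f i == f (i + 1)) then CrossingSign.pos else CrossingSign.neg

end LocalTangle

namespace PseudoDiagram

open LocalTangle

/-- Planar isotopies, the oriented Reidemeister moves, and the moves for precrossings. -/
inductive Move : PseudoDiagram → PseudoDiagram → Prop where
  | isotopy {P Q : PseudoDiagram} (h : OrientedDiagram.IsotopyStep P Q) : Move P Q
  /-- Removal of a curl, `R1` for a classical crossing and `PR1` for a precrossing. -/
  | r1 (E : Exterior (Option CrossingSign) Unit) (s : Bool) (k : Option CrossingSign) :
      Move (E.fill (curl s k)) (E.fill (LocalTangle.trivial _ Unit))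
  /-- `R2`: one strand runs over both crossings exactly if the signs differ. -/
  | r2_parallel (E : Exterior (Option CrossingSign) Bool) (k l : CrossingSign)
      (h : k ≠ l) :
      Move (E.fill (parallelBigon (some k) (some l))) (E.fill (LocalTangle.trivial _ Bool))
  | r2_antiparallel (E : Exterior (Option CrossingSign) Bool) (s : Bool) (k l : CrossingSign)
      (h : k ≠ l) :
      Move (E.fill (antiparallelBigon s (some k) (some l))) (E.fill (LocalTangle.trivial _ Bool))
  /-- `PR2`: a precrossing and a classical crossing on a bigon change places. -/
  | pr2_parallel (E : Exterior (Option CrossingSign) Bool) (k : CrossingSign) :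
      Move (E.fill (parallelBigon none (some k))) (E.fill (parallelBigon (some k) none))
  | pr2_antiparallel (E : Exterior (Option CrossingSign) Bool) (s : Bool) (k : CrossingSign) :
      Move (E.fill (antiparallelBigon s none (some k)))
        (E.fill (antiparallelBigon s (some k) none))
  /-- `R3`: the three strands have different heights, that is, `o` is not cyclic. -/
  | r3 (E : Exterior (Option CrossingSign) (Fin 3)) (f o : Fin 3 → Bool)
      (h : ¬ (o 0 = o 1 ∧ o 1 = o 2)) :
      Move (E.fill (triangle f false fun i => some (triangleSign f o i)))
        (E.fill (triangle f true fun i => some (triangleSign f o i)))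
  /-- `PR3`: the strands `0` and `1` meet in a precrossing, and the strand `2` runs over both or
  under both. -/
  | pr3 (E : Exterior (Option CrossingSign) (Fin 3)) (f o : Fin 3 → Bool) (h : o 1 ≠ o 2) :
      Move (E.fill (triangle f false fun i => if i = 0 then none else some (triangleSign f o i)))
        (E.fill (triangle f true fun i => if i = 0 then none else some (triangleSign f o i)))

/-- Two pseudodiagrams represent the same oriented pseudolink: they are joined by moves between
planar pseudodiagrams. -/
def SamePseudolink : PseudoDiagram → PseudoDiagram → Prop :=
  Relation.EqvGen fun P Q => P.IsPlanar ∧ Q.IsPlanar ∧ Move P Q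

/-- A diagram of a trivial link (disjoint circles, any number of them): no crossings and no
precrossings. -/
def IsTrivial (P : PseudoDiagram) : Prop := IsEmpty P.V

/-- The precrossings. -/
abbrev Precrossing (P : PseudoDiagram) : Type := {v : P.V // ¬ (P.label v).isSome = true}

/-- The crossings with over/under information. -/
abbrev ClassicalCrossing (P : PseudoDiagram) : Type := {v : P.V // (P.label v).isSome = true}

/-- Ends of arcs after every precrossing has been replaced by two points, one for each side. -/
def splitPrecrossings (P : PseudoDiagram) :
    (P.ClassicalCrossing × Bool) ⊕ (P.W ⊕ (P.Precrossing × Bool)) ≃ (P.V × Bool) ⊕ P.W :=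
  ((Equiv.sumCongr (Equiv.refl _) (Equiv.sumComm _ _)).trans
    (Equiv.sumAssoc _ _ _).symm).trans
    (Equiv.sumCongr ((Equiv.sumProdDistrib _ _ _).symm.trans
      ((Equiv.sumCompl fun v => (P.label v).isSome = true).prodCongr (Equiv.refl Bool)))
      (Equiv.refl _))

/-- Insertion of the oriented `0`-tangle at every precrossing, respecting the orientation: the
strand that comes in on side `s` now goes out on side `s`, without a crossing. -/
def insertZeroTangle (P : PseudoDiagram) : LinkDiagram where
  V := P.ClassicalCrossing
  W := P.W ⊕ (P.Precrossing × Bool)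
  label := fun v => (P.label v.1).get v.2
  next := P.splitPrecrossings.trans (P.next.trans P.splitPrecrossings.symm)

section TangleInsertion

variable {R : Type} [CommRing R] (I : LinkDiagram → R)

/-- The polynomial obtained from the link invariant `I` by the recursion that replaces a precrossing
by the `0`-tangle and multiplies by the variable `X`. -/
noncomputable def insertionPolynomial (P : PseudoDiagram) : Polynomial R :=
  Polynomial.X ^ Fintype.card P.Precrossing * Polynomial.C (I P.insertZeroTangle)

/-- Coefficients modulo the relation `X * I (D (0-tangle)) = 1`. -/
abbrev InsertionRing : Type :=
  Polynomial R ⧸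
    Ideal.span {Polynomial.X * Polynomial.C (I LinkDiagram.twoCircles) - 1}

/-- The tangle insertion invariant of `I` with the `0`-tangle as the only tangle. -/
noncomputable def tangleInsertion (P : PseudoDiagram) : InsertionRing I :=
  Ideal.Quotient.mk _ (insertionPolynomial I P)

end TangleInsertion

end PseudoDiagram

/-! The examples, from planar diagram codes.  In a code, `[a, b, c, d]` lists the arcs around a
crossing counterclockwise, beginning with the incoming arc of the under-strand; each arc is
identified with the passage at its end, and numbered from `0` below. -/

/-- Borromean rings, with code `[6,1,7,2] [12,8,9,7] [4,12,1,11] [10,5,11,6] [8,4,5,3] [2,9,3,10]`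
and components `1-4`, `5-8`, `9-12`; the first crossing, a negative one, has become a
precrossing. -/
def pseudoBorromean : PseudoDiagram :=
  OrientedDiagram.ofGauss (n := 6) (m := 12)
    ![none, some .pos, some .pos, some .neg, some .pos, some .neg]
    { toFun := ![(0, true), (5, false), (4, false), (2, true), (3, true), (0, false), (1, false),
        (4, true), (5, true), (3, false), (2, false), (1, true)]
      invFun := fun q => ![![5, 0], ![6, 11], ![10, 3], ![9, 4], ![2, 7], ![1, 8]] q.1
        (if q.2 then 1 else 0)
      left_inv := by decide
      right_inv := by decide }
    { toFun := ![1, 2, 3, 0, 5, 6, 7, 4, 9, 10, 11, 8]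
      invFun := ![3, 0, 1, 2, 7, 4, 5, 6, 11, 8, 9, 10]
      left_inv := by decide
      right_inv := by decide }

/-- The Whitehead link: the diagram with code `[6,1,7,2] [10,7,5,8] [4,5,1,6] [2,10,3,9] [8,4,9,3]`
and components `1-4`, `5-10`, with all crossings switched. -/
def whiteheadLink : LinkDiagram :=
  OrientedDiagram.ofGauss (n := 5) (m := 10)
    ![.pos, .pos, .pos, .neg, .neg]
    { toFun := ![(0, true), (3, true), (4, false), (2, false), (2, true), (0, false), (1, true),
        (4, true), (3, false), (1, false)]
      invFun := fun q => ![![5, 0], ![9, 6], ![3, 4], ![8, 1], ![2, 7]] q.1 (if q.2 then 1 else 0)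
      left_inv := by decide
      right_inv := by decide }
    { toFun := ![1, 2, 3, 0, 5, 6, 7, 8, 9, 4]
      invFun := ![3, 0, 1, 2, 9, 4, 5, 6, 7, 8]
      left_inv := by decide
      right_inv := by decide }

/-- `- A ^ 6 + A ^ 2 - 2 A ^ (-2) + A ^ (-6) - 2 A ^ (-10) + A ^ (-14)` -/
noncomputable def whiteheadPolynomial : ℤ[T;T⁻¹] :=
  -LaurentPolynomial.T 6 + LaurentPolynomial.T 2 - 2 * LaurentPolynomial.T (-2)
    + LaurentPolynomial.T (-6) - 2 * LaurentPolynomial.T (-10) + LaurentPolynomial.T (-14)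

/-! The tangle insertion invariant of the Jones polynomial is itself a state sum with local weights.
The writhe factor is distributed over the crossings, so that a positive crossing has weights `-A⁻²`
(oriented smoothing) and `-A⁻⁴` (the other one), and a negative crossing has the mirror images. A
precrossing has weights `X` and `0`: only states that smooth it along the orientation survive. This
is `PseudoDiagram.tangleInsertion_jones_eq_stateSum`.

A state sum can be cut along a disc (`Exterior.stateSum_fill`): for a fixed exterior it depends on
the tangle only through the total weight of each pattern in which the ends are connected. Every move
thus becomes an identity between small tangles, for an arbitrary function `F` of patterns. R1 and
PR1 both say that (oriented weight) `* d +` (other weight) `= 1`; for a precrossing this is `X * d =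
1`, the relation imposed on `X`. R2 is the usual cancellation. PR2 holds because the coefficients
for a bigon are symmetric in its two crossings. In R3 and PR3, pushing a strand across exchanges two
patterns and keeps three, and the coefficients of the exchanged patterns agree as soon as one strand
is over or under both others; the third crossing may have any weights, so it may be a precrossing.
The result is `PseudoDiagram.Move.stateSum_eq`.

For the example, smoothing the precrossing gives the Whitehead diagram with two extra points, and
its 32 states are enumerated. A diagram without crossings has as value a power of `δ`, which is
symmetric under `A ↔ A⁻¹`, whereas `V / δ` is not: evaluation at `A = 2` and `A = 1/2` separates
them. For `q ^ lk` both values are `1`.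

Curves, faces, pieces and strands are all classes of an equivalence relation generated by finitely
many pairs. They are counted by merging labels along a list of pairs, which the kernel can evaluate.
-/

/-! ### Counting classes of generated equivalence relations -/

/-- Maps between two types that respect generating relations and are inverse up to them give a
bijection of the quotients. -/
theorem card_quot_eq_of_inverse {α β : Type} {r : α → α → Prop} {r' : β → β → Prop}
    (f : α → β) (g : β → α)
    (hf : ∀ x y, r x y → Quot.mk r' (f x) = Quot.mk r' (f y))
    (hg : ∀ x y, r' x y → Quot.mk r (g x) = Quot.mk r (g y))
    (hgf : ∀ x, Quot.mk r (g (f x)) = Quot.mk r x)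
    (hfg : ∀ y, Quot.mk r' (f (g y)) = Quot.mk r' y) :
    Nat.card (Quot r) = Nat.card (Quot r') :=
  Nat.card_congr
    { toFun := Quot.lift (fun x => Quot.mk r' (f x)) hf
      invFun := Quot.lift (fun y => Quot.mk r (g y)) hg
      left_inv := by rintro ⟨x⟩; exact hgf x
      right_inv := by rintro ⟨y⟩; exact hfg y }

theorem card_quot_congr {α β : Type} {r : α → α → Prop} {r' : β → β → Prop} (e : α ≃ β)
    (h : ∀ x y, r x y → Quot.mk r' (e x) = Quot.mk r' (e y))
    (h' : ∀ x y, r' x y → Quot.mk r (e.symm x) = Quot.mk r (e.symm y)) :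
    Nat.card (Quot r) = Nat.card (Quot r') :=
  card_quot_eq_of_inverse e e.symm h h' (by simp) (by simp)

/-- Two sets with relations, glued along a set of points `S` that maps to both. -/
inductive GlueRel {X Y S : Type} (rX : X → X → Prop) (rY : Y → Y → Prop) (f : S → X) (g : S → Y) :
    X ⊕ Y → X ⊕ Y → Prop where
  | left {x x' : X} (h : rX x x') : GlueRel rX rY f g (Sum.inl x) (Sum.inl x')
  | right {y y' : Y} (h : rY y y') : GlueRel rX rY f g (Sum.inr y) (Sum.inr y')
  | glue (s : S) : GlueRel rX rY f g (Sum.inl (f s)) (Sum.inr (g s))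

/-- The relation `rX`, together with identifications of points of `S` by the relation `p`. -/
def closeUp {X S : Type} (rX : X → X → Prop) (f : S → X) (p : S → S → Prop) (x x' : X) : Prop :=
  rX x x' ∨ ∃ s s', p s s' ∧ x = f s ∧ x' = f s'

open Classical in
/-- The classes of a glued set are those that meet the first part, and those of the second part
which do not meet `S`. -/
theorem card_quot_glueRel {X Y S : Type} [Finite X] [Finite Y] (rX : X → X → Prop)
    (rY : Y → Y → Prop) (f : S → X) (g : S → Y) :
    Nat.card (Quot (GlueRel rX rY f g)) =
      Nat.card (Quot (closeUp rX f fun s s' => Quot.mk rY (g s) = Quot.mk rY (g s'))) +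
        Nat.card {y : Quot rY // ∀ s, Quot.mk rY (g s) ≠ y} := by
  set p : S → S → Prop := fun s s' => Quot.mk rY (g s) = Quot.mk rY (g s') with hp
  rw [← Nat.card_sum]
  -- A class of the second part that meets `S` is carried across the glue. The chosen point of `S`
  -- is immaterial: two choices lie in one class of `rY`, so `p` identifies their images under `f`.
  let φ : Quot rY → Quot (closeUp rX f p) ⊕ {y : Quot rY // ∀ s, Quot.mk rY (g s) ≠ y} := fun y =>
    if h : ∃ s, Quot.mk rY (g s) = y then Sum.inl (Quot.mk _ (f h.choose))
    else Sum.inr ⟨y, fun s hs => h ⟨s, hs⟩⟩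
  have hφ : ∀ s, φ (Quot.mk rY (g s)) = Sum.inl (Quot.mk _ (f s)) := by
    intro s
    have h : ∃ s', Quot.mk rY (g s') = Quot.mk rY (g s) := ⟨s, rfl⟩
    simp only [φ, dif_pos h]
    exact congrArg Sum.inl (Quot.sound (Or.inr ⟨_, _, h.choose_spec, rfl, rfl⟩))
  have hglue : ∀ s, Quot.mk (GlueRel rX rY f g) (Sum.inl (f s)) = Quot.mk _ (Sum.inr (g s)) :=
    fun s => Quot.sound (GlueRel.glue s)
  let ψ : Quot rY → Quot (GlueRel rX rY f g) :=
    Quot.lift (fun y => Quot.mk _ (Sum.inr y)) fun y y' h => Quot.sound (GlueRel.right h)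
  refine Nat.card_congr
    { toFun := Quot.lift (Sum.elim (fun x => Sum.inl (Quot.mk _ x)) fun y => φ (Quot.mk _ y)) ?_
      invFun := Sum.elim (Quot.lift (fun x => Quot.mk _ (Sum.inl x)) ?_) fun y => ψ y.1
      left_inv := ?_
      right_inv := ?_ }
  · rintro _ _ (h | h | s)
    · exact congrArg Sum.inl (Quot.sound (Or.inl h))
    · exact congrArg φ (Quot.sound h)
    · exact (hφ s).symm
  · rintro x x' (h | ⟨s, s', h, rfl, rfl⟩)
    · exact Quot.sound (GlueRel.left h)
    · rw [hglue, hglue]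
      exact congrArg ψ h
  · rintro ⟨x | y⟩
    · rfl
    · change Sum.elim _ _ (φ (Quot.mk _ y)) = ψ (Quot.mk _ y)
      by_cases h : ∃ s, Quot.mk rY (g s) = Quot.mk rY y
      · obtain ⟨s, hs⟩ := h
        rw [← hs, hφ]
        exact hglue s
      · simp only [φ, dif_neg h, Sum.elim_inr]
  · rintro (⟨⟨x⟩⟩ | ⟨⟨y⟩, hy⟩)
    · rfl
    · change φ (Quot.mk _ y) = _
      have h : ¬ ∃ s, Quot.mk rY (g s) = Quot.mk rY y := fun ⟨s, hs⟩ => hy s hs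
      simp only [φ, dif_neg h]

/-! ### An algorithm for the classes -/

/-- Identify the classes of the two ends of an edge; a class is given by its label. -/
def mergeLabels (l : List ℕ) (e : ℕ × ℕ) : List ℕ :=
  l.map fun x => bif Nat.beq x (l.getD e.2 0) then l.getD e.1 0 else x

/-- Labels for the connected components of a graph with vertices `0, ..., n - 1`. -/
def classLabels (n : ℕ) (es : List (ℕ × ℕ)) : List ℕ := es.foldl mergeLabels (List.range n)

theorem length_mergeLabels (l : List ℕ) (e : ℕ × ℕ) : (mergeLabels l e).length = l.length := by
  simp [mergeLabels]

theorem getD_mergeLabels (l : List ℕ) (e : ℕ × ℕ) {i : ℕ} (hi : i < l.length) :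
    (mergeLabels l e).getD i 0 =
      if l.getD i 0 = l.getD e.2 0 then l.getD e.1 0 else l.getD i 0 := by
  simp only [mergeLabels, List.getD_eq_getElem?_getD, List.getElem?_map, hi,
    List.getElem?_eq_getElem, Option.map_some, Option.getD_some, cond_eq_ite, Nat.beq_eq]

/-- The invariant of the merging algorithm: labels agree exactly on the classes generated so far. In
the induction each processed pair is absorbed into `r`. -/
theorem getD_foldl_mergeLabels {α : Type} {n : ℕ} (enc : α → Fin n) (es : List (α × α)) :
    ∀ (l : List ℕ) (r : α → α → Prop), l.length = n →
      (∀ x y, l.getD (enc x) 0 = l.getD (enc y) 0 ↔ Relation.EqvGen r x y) → ∀ x y,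
      ((es.map fun e => ((enc e.1 : ℕ), (enc e.2 : ℕ))).foldl mergeLabels l).getD (enc x) 0 =
          ((es.map fun e => ((enc e.1 : ℕ), (enc e.2 : ℕ))).foldl mergeLabels l).getD (enc y) 0 ↔
        Relation.EqvGen (fun a b => r a b ∨ (a, b) ∈ es) x y := by
  induction es with
  | nil => intro l r _ h x y; simpa using h x y
  | cons e es ih =>
    intro l r hl h x y
    have key := ih (mergeLabels l (enc e.1, enc e.2)) (fun a b => r a b ∨ (a, b) = e)
      (by rw [length_mergeLabels, hl]) ?_ x y
    · simp only [List.map_cons, List.foldl_cons, key, List.mem_cons, or_assoc]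
    · intro x y
      have hlt : ∀ z, (enc z : ℕ) < l.length := fun z => hl ▸ (enc z).2
      have mono : ∀ {a b}, l.getD (enc a) 0 = l.getD (enc b) 0 →
          Relation.EqvGen (fun a b => r a b ∨ (a, b) = e) a b := fun {a b} hab =>
        Relation.EqvGen.mono (fun _ _ => Or.inl) _ _ ((h a b).1 hab)
      have he : Relation.EqvGen (fun a b => r a b ∨ (a, b) = e) e.1 e.2 := .rel _ _ (Or.inr rfl)
      rw [getD_mergeLabels _ _ (hlt x), getD_mergeLabels _ _ (hlt y)]
      constructor
      · intro hxy
        split_ifs at hxy with h1 h2 h2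
        · exact mono (h1.trans h2.symm)
        · exact ((mono h1).trans _ _ _ (he.symm _ _)).trans _ _ _ (mono hxy)
        · exact ((mono hxy).trans _ _ _ he).trans _ _ _ (mono h2.symm)
        · exact mono hxy
      · intro hxy
        induction hxy with
        | rel a b hab =>
          rcases hab with hab | rfl
          · rw [(h a b).2 (.rel _ _ hab)]
          · simp
        | refl => rfl
        | symm _ _ _ ih => exact ih.symm
        | trans _ _ _ _ _ ih₁ ih₂ => exact ih₁.trans ih₂

/-- The labels of the classes generated by the pairs in `es`. -/
def edgeLabels {α : Type} {n : ℕ} (enc : α → Fin n) (es : List (α × α)) : List ℕ :=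
  classLabels n (es.map fun e => ((enc e.1 : ℕ), (enc e.2 : ℕ)))

theorem length_edgeLabels {α : Type} {n : ℕ} (enc : α → Fin n) (es : List (α × α)) :
    (edgeLabels enc es).length = n := by
  have : ∀ (es : List (ℕ × ℕ)) (l : List ℕ), (es.foldl mergeLabels l).length = l.length := by
    intro es
    induction es with
    | nil => simp
    | cons e es ih => intro l; rw [List.foldl_cons, ih, length_mergeLabels]
  rw [edgeLabels, classLabels, this, List.length_range]

/-- The fold starts from pairwise distinct labels and the empty relation. From here on, equality of
classes is a computation with natural numbers. -/
theorem quot_mk_eq_iff_edgeLabels {α : Type} {n : ℕ} {enc : α → Fin n}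
    (henc : Function.Injective enc) {es : List (α × α)} {r : α → α → Prop}
    (hr : ∀ x y, r x y ↔ (x, y) ∈ es) (x y : α) :
    Quot.mk r x = Quot.mk r y ↔
      (edgeLabels enc es).getD (enc x) 0 = (edgeLabels enc es).getD (enc y) 0 := by
  rw [Quot.eq]
  obtain rfl : r = fun x y => (x, y) ∈ es := by ext x y; exact hr x y
  have := getD_foldl_mergeLabels enc es (List.range n) (fun _ _ => False) (by simp) (by
    intro x y
    have hrange : ∀ z, (List.range n).getD (enc z) 0 = enc z := by
      intro z; simp [List.getD_eq_getElem?_getD]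
    rw [hrange, hrange]
    constructor
    · intro h
      rw [henc (Fin.ext h)]
      exact .refl _
    · intro h
      induction h with
      | rel _ _ h => exact h.elim
      | refl => rfl
      | symm _ _ _ ih => exact ih.symm
      | trans _ _ _ _ _ ih₁ ih₂ => exact ih₁.trans ih₂) x y
  simpa [edgeLabels, classLabels] using this.symm

/-- The number of classes which contain none of the points `b s`. -/
theorem card_quot_avoiding {α S : Type} {n : ℕ} {enc : α → Fin n}
    (henc : Function.Bijective enc) {es : List (α × α)} {r : α → α → Prop}
    (hr : ∀ x y, r x y ↔ (x, y) ∈ es) (b : S → α) (bl : List ℕ)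
    (hbl : ∀ x, x ∈ bl ↔ ∃ s, (edgeLabels enc es).getD (enc (b s)) 0 = x) :
    Nat.card {y : Quot r // ∀ s, Quot.mk r (b s) ≠ y} =
      ((edgeLabels enc es).dedup.filter fun x => !bl.contains x).length := by
  set l := edgeLabels enc es with hl
  have hq := quot_mk_eq_iff_edgeLabels henc.1 hr
  have hnd : (l.dedup.filter fun x => !bl.contains x).Nodup := (List.nodup_dedup l).filter _
  rw [← List.toFinset_card_of_nodup hnd, ← Nat.card_eq_finsetCard]
  refine Nat.card_congr (Equiv.ofBijective (fun y => ⟨Quot.lift (fun x => l.getD (enc x) 0)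
    (fun x y h => (hq x y).1 (Quot.sound h)) y.1, ?_⟩) ⟨?_, ?_⟩)
  · obtain ⟨⟨x⟩, hx⟩ := y
    have hlt : (enc x : ℕ) < l.length := by rw [hl, length_edgeLabels]; exact (enc x).2
    simp only [List.mem_toFinset, List.mem_filter, List.mem_dedup]
    refine ⟨?_, ?_⟩
    · rw [List.getD_eq_getElem _ _ hlt]; exact List.getElem_mem hlt
    · simp only [Bool.not_eq_true', List.contains_eq_mem, decide_eq_false_iff_not, hbl]
      rintro ⟨s, hs⟩
      exact hx s ((hq _ _).2 hs)
  · rintro ⟨⟨x⟩, hx⟩ ⟨⟨y⟩, hy⟩ h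
    simp only [Subtype.mk.injEq] at h
    exact Subtype.ext ((hq x y).2 h)
  · rintro ⟨k, hk⟩
    simp only [List.mem_toFinset, List.mem_filter, List.mem_dedup,
      Bool.not_eq_true', List.contains_eq_mem, decide_eq_false_iff_not, hbl] at hk
    obtain ⟨⟨i, hi, rfl⟩, hk⟩ := (And.imp_left List.mem_iff_getElem.1 hk)
    obtain ⟨x, hx⟩ := henc.2 ⟨i, by rwa [hl, length_edgeLabels] at hi⟩
    have hxi : l.getD (enc x) 0 = l[i] := by rw [hx, List.getD_eq_getElem _ _ hi]
    refine ⟨⟨Quot.mk _ x, fun s hs => hk ⟨s, ?_⟩⟩, ?_⟩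
    · rw [← hxi]; exact (hq _ _).1 hs
    · exact Subtype.ext hxi

theorem card_quot_eq_length_dedup {α : Type} {n : ℕ} {enc : α → Fin n}
    (henc : Function.Bijective enc) {es : List (α × α)} {r : α → α → Prop}
    (hr : ∀ x y, r x y ↔ (x, y) ∈ es) :
    Nat.card (Quot r) = (edgeLabels enc es).dedup.length := by
  have h := card_quot_avoiding (S := Empty) henc hr (fun s => s.elim) [] (by simp)
  rw [List.filter_eq_self.2 (by simp)] at h
  rw [← h]
  exact Nat.card_congr (Equiv.subtypeUnivEquiv fun y s => s.elim).symm

/-! ### State sums -/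

/-- The relation between consecutive arcs of the curves in a state `σ`, for arcs in a set `A`: the
arc `src x` starts at `x`, and the arc `tgt x` ends at `x`. -/
inductive Smoothing {V W A : Type} (src tgt : (V × Bool) ⊕ W → A) (σ : V → Bool) :
    A → A → Prop where
  | oriented (v : V) (s : Bool) (h : σ v = true) :
      Smoothing src tgt σ (tgt (Sum.inl (v, s))) (src (Sum.inl (v, s)))
  | bottom (v : V) (h : σ v = false) :
      Smoothing src tgt σ (tgt (Sum.inl (v, false))) (tgt (Sum.inl (v, true)))
  | top (v : V) (h : σ v = false) :
      Smoothing src tgt σ (src (Sum.inl (v, false))) (src (Sum.inl (v, true)))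
  | point (w : W) : Smoothing src tgt σ (tgt (Sum.inr w)) (src (Sum.inr w))

/-- A map that commutes with `src` and `tgt` up to the equivalence relation generated in the
target respects the smoothing relation. -/
theorem Smoothing.map_eq {V W A Q : Type} {src tgt : (V × Bool) ⊕ W → A} {σ : V → Bool} (q : A → Q)
    {V' W' A' : Type} {src' tgt' : (V' × Bool) ⊕ W' → A'} {σ' : V' → Bool} (φ : A' → Q)
    (hφ : ∀ x y, Smoothing src' tgt' σ' x y → φ x = φ y) (v : V → V') (w : W → W')
    (hσ : ∀ x, σ' (v x) = σ x)
    (hsrc : ∀ x, q (src x) = φ (src' (Sum.map (Prod.map v id) w x)))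
    (htgt : ∀ x, q (tgt x) = φ (tgt' (Sum.map (Prod.map v id) w x))) (x y : A)
    (h : Smoothing src tgt σ x y) : q x = q y := by
  rcases h with ⟨x, s, h⟩ | ⟨x, h⟩ | ⟨x, h⟩ | x
  · rw [hsrc, htgt]; exact hφ _ _ (.oriented _ _ ((hσ x).trans h))
  · rw [htgt, htgt]; exact hφ _ _ (.bottom _ ((hσ x).trans h))
  · rw [hsrc, hsrc]; exact hφ _ _ (.top _ ((hσ x).trans h))
  · rw [hsrc, htgt]; exact hφ _ _ (.point _)

/-! ### Invariance of state sums under planar isotopy -/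

namespace OrientedDiagram

variable {κ : Type} {K : Type} [CommRing K]

/-- The number of closed curves in a state. -/
noncomputable def loopCount (D : OrientedDiagram κ) (σ : D.V → Bool) : ℕ :=
  Nat.card (Quot (Smoothing id D.next.symm σ))

open Classical in
/-- The state sum in which a crossing with label `k` has weight `w k true` for the smoothing that
respects the orientation and `w k false` for the other one. -/
noncomputable def stateSum (w : κ → Bool → K) (d : K) (D : OrientedDiagram κ) : K :=
  ∑ σ : D.V → Bool, (∏ v, w (D.label v) (σ v)) * d ^ (D.loopCount σ - 1)

theorem Iso.next_symm_eq {D D' : OrientedDiagram κ} (e : D.Iso D') (a : D.Arc) :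
    D'.next.symm (Sum.map (Prod.map e.v id) e.w a) =
      Sum.map (Prod.map e.v id) e.w (D.next.symm a) := by
  rw [Equiv.symm_apply_eq, e.next_eq, Equiv.apply_symm_apply]

theorem Iso.loopCount_eq {D D' : OrientedDiagram κ} (e : D.Iso D') (σ : D'.V → Bool) :
    D.loopCount (σ ∘ e.v) = D'.loopCount σ := by
  have hsymm : ∀ b, (Sum.map (Prod.map e.v.symm id) e.w.symm
      (Sum.map (Prod.map e.v id) e.w b) : D.Arc) = b := by
    rintro (⟨v, s⟩ | w) <;> simp
  have hsymm' : ∀ b, (Sum.map (Prod.map e.v id) e.w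
      (Sum.map (Prod.map e.v.symm id) e.w.symm b) : D'.Arc) = b := by
    rintro (⟨v, s⟩ | w) <;> simp
  refine card_quot_eq_of_inverse (Sum.map (Prod.map e.v id) e.w)
    (Sum.map (Prod.map e.v.symm id) e.w.symm) ?_ ?_ (fun x => by rw [hsymm])
    (fun x => by rw [hsymm'])
  · exact Smoothing.map_eq _ (Quot.mk (Smoothing id D'.next.symm σ)) (fun _ _ => Quot.sound)
      e.v e.w (fun _ => rfl) (fun _ => rfl) fun x => by rw [e.next_symm_eq]
  · refine Smoothing.map_eq _ (Quot.mk (Smoothing id D.next.symm (σ ∘ e.v)))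
      (fun _ _ => Quot.sound) e.v.symm e.w.symm (fun _ => by simp) (fun _ => rfl) fun x => ?_
    conv_lhs => rw [← hsymm' x, e.next_symm_eq, hsymm]

theorem Iso.stateSum_eq {D D' : OrientedDiagram κ} (e : D.Iso D') (w : κ → Bool → K) (d : K) :
    D.stateSum w d = D'.stateSum w d := by
  classical
  refine Fintype.sum_equiv (e.v.arrowCongr (Equiv.refl Bool)) _ _ fun σ => ?_
  have hσ : σ = (e.v.arrowCongr (Equiv.refl Bool) σ) ∘ e.v := by ext; simp
  congr 1
  · refine Fintype.prod_equiv e.v _ _ fun v => ?_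
    rw [e.label_eq]; simp
  · conv_lhs => rw [hσ, e.loopCount_eq]

/-- The new point cuts `a` into two consecutive arcs, which every state joins again at that point;
contracting the second onto the first is inverse to the inclusion of the old arcs, up to the
relation. -/
theorem loopCount_subdivide (D : OrientedDiagram κ) (a : D.Arc) (σ : D.V → Bool) :
    (D.subdivide a).loopCount σ = D.loopCount σ := by
  classical
  let ρ : D.Arc ⊕ Unit ≃ (D.subdivide a).Arc := Equiv.sumAssoc _ _ _
  have hnext : ∀ e : D.Arc ⊕ Unit, (D.subdivide a).next.symm (ρ e) =
      ρ (Equiv.swap (Sum.inl a) (Sum.inr ()) (Sum.map D.next.symm id e)) := by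
    have h : ∀ x, (D.subdivide a).next (ρ x) =
        ρ (Sum.map D.next id (Equiv.swap (Sum.inl a) (Sum.inr ()) x)) := by
      rintro ((_ | _) | _) <;> rfl
    intro e
    rw [Equiv.symm_apply_eq, h, Equiv.swap_apply_self]
    rcases e with e | e <;> simp
  let q := Quot.mk (Smoothing id (D.subdivide a).next.symm σ)
  have hnew : q (ρ (Sum.inl a)) = q (ρ (Sum.inr ())) := by
    have := hnext (Sum.inr ())
    simp only [Sum.map_inr, id_eq, Equiv.swap_apply_right] at this
    rw [← this]
    exact Quot.sound (Smoothing.point (V := D.V) (W := D.W ⊕ Unit) (Sum.inr ()))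
  have hq : ∀ b : D.Arc, q ((D.subdivide a).next.symm (ρ (Sum.inl b))) =
      q (ρ (Sum.inl (D.next.symm b))) := by
    intro b
    rw [hnext]
    by_cases h : D.next.symm b = a
    · simp only [Sum.map_inl, h, Equiv.swap_apply_left, hnew]
    · rw [Sum.map_inl, Equiv.swap_apply_of_ne_of_ne (by simpa using h) (by simp)]
  -- The contraction: the arc that starts at the new point goes to `a`.
  let g : (D.subdivide a).Arc → D.Arc := fun b => Sum.elim id (fun _ => a) (ρ.symm b)
  have hg : ∀ b : D.Arc, g ((D.subdivide a).next.symm (ρ (Sum.inl b))) = D.next.symm b := by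
    intro b
    rw [hnext]
    by_cases h : D.next.symm b = a
    · simp only [g, Sum.map_inl, h, Equiv.swap_apply_left, Equiv.symm_apply_apply, Sum.elim_inr]
    · rw [Sum.map_inl, Equiv.swap_apply_of_ne_of_ne (by simpa using h) (by simp)]
      simp only [g, Equiv.symm_apply_apply, Sum.elim_inl, id_eq]
  refine (card_quot_eq_of_inverse (fun b => ρ (Sum.inl b)) g ?_ ?_ (fun b => ?_) ?_).symm
  · refine Smoothing.map_eq (fun b => q (ρ (Sum.inl b))) q (fun _ _ => Quot.sound) (W := D.W)
      id Sum.inl (fun _ => rfl) ?_ ?_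
    · rintro (⟨v, s⟩ | w) <;> rfl
    · rintro (⟨v, s⟩ | w) <;> exact (hq _).symm
  · rintro _ _ (⟨v, s, h⟩ | ⟨v, h⟩ | ⟨v, h⟩ | w | w)
    · have := hg (Sum.inl (v, s))
      exact (congrArg _ this).trans
        (Quot.sound (Smoothing.oriented (src := (id : D.Arc → D.Arc)) (tgt := D.next.symm) v s h))
    · exact (congrArg _ (hg (Sum.inl (v, false)))).trans ((Quot.sound
        (Smoothing.bottom (src := (id : D.Arc → D.Arc)) (tgt := D.next.symm) v h)).trans
          (congrArg _ (hg (Sum.inl (v, true)))).symm)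
    · exact Quot.sound (Smoothing.top (src := (id : D.Arc → D.Arc)) (tgt := D.next.symm) v h)
    · exact (congrArg _ (hg (Sum.inr w))).trans
        (Quot.sound (Smoothing.point (src := (id : D.Arc → D.Arc)) (tgt := D.next.symm) w))
    · have := hnext (Sum.inr ())
      simp only [Sum.map_inr, id_eq, Equiv.swap_apply_right] at this
      refine (congrArg (fun b => Quot.mk (Smoothing id D.next.symm σ) (g b)) this).trans ?_
      have hga : g (ρ (Sum.inl a)) = a := by
        simp only [g, Equiv.symm_apply_apply, Sum.elim_inl, id_eq]
      exact congrArg (Quot.mk _) hga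
  · simp only [g, Equiv.symm_apply_apply, Sum.elim_inl, id_eq]
  · intro b
    obtain ⟨b | b, rfl⟩ := ρ.surjective b
    · simp only [g, Equiv.symm_apply_apply, Sum.elim_inl, id_eq]
    · simp only [g, Equiv.symm_apply_apply, Sum.elim_inr]
      exact hnew

theorem stateSum_subdivide (D : OrientedDiagram κ) (a : D.Arc) (w : κ → Bool → K) (d : K) :
    (D.subdivide a).stateSum w d = D.stateSum w d := by
  refine Finset.sum_congr rfl fun σ _ => ?_
  exact congrArg (fun n => (∏ v, w (D.label v) (σ v)) * d ^ (n - 1)) (D.loopCount_subdivide a σ)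

theorem IsotopyStep.stateSum_eq {D D' : OrientedDiagram κ} (h : IsotopyStep D D')
    (w : κ → Bool → K) (d : K) : D.stateSum w d = D'.stateSum w d := by
  cases h with
  | iso e => exact e.stateSum_eq w d
  | subdivide a => exact (D.stateSum_subdivide a w d).symm

theorem PlanarIsotopic.stateSum_eq {D D' : OrientedDiagram κ} (h : PlanarIsotopic D D')
    (w : κ → Bool → K) (d : K) : D.stateSum w d = D'.stateSum w d := by
  induction h with
  | rel _ _ h => exact h.stateSum_eq w d
  | refl => rfl
  | symm _ _ _ ih => exact ih.symm
  | trans _ _ _ _ _ ih₁ ih₂ => exact ih₁.trans ih₂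

end OrientedDiagram

/-! ### State sums of tangles -/

namespace LocalTangle

variable {κ ι K : Type} [CommRing K]

/-- Consecutive arcs of the curves in a state, inside the disc. -/
def Step (t : LocalTangle κ ι) (τ : t.V → Bool) : (t.V × Bool) ⊕ ι → (t.V × Bool) ⊕ ι → Prop :=
  Smoothing (W := Empty) (Sum.map id Empty.elim) (fun x => t.wiring.symm (Sum.map id Empty.elim x)) τ

/-- The arcs inside the disc at its inputs and outputs. -/
def ends (t : LocalTangle κ ι) : ι ⊕ ι → (t.V × Bool) ⊕ ι :=
  Sum.elim Sum.inr fun i => t.wiring.symm (Sum.inr i)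

/-- The way in which a state connects the ends of the tangle. -/
def pattern (t : LocalTangle κ ι) (τ : t.V → Bool) (s s' : ι ⊕ ι) : Prop :=
  Quot.mk (t.Step τ) (t.ends s) = Quot.mk (t.Step τ) (t.ends s')

/-- The number of curves of a state that do not reach the boundary of the disc. -/
noncomputable def closedLoops (t : LocalTangle κ ι) (τ : t.V → Bool) : ℕ :=
  Nat.card {y : Quot (t.Step τ) // ∀ s, Quot.mk (t.Step τ) (t.ends s) ≠ y}

open Classical in
/-- The state sum of a tangle, whose value on a pattern of connections is `F`. -/
noncomputable def stateSum (w : κ → Bool → K) (d : K) (t : LocalTangle κ ι)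
    (F : (ι ⊕ ι → ι ⊕ ι → Prop) → K) : K :=
  ∑ τ : t.V → Bool, (∏ v, w (t.label v) (τ v)) * (d ^ t.closedLoops τ * F (t.pattern τ))

end LocalTangle

namespace Exterior

variable {κ ι K : Type} [CommRing K]

/-- Consecutive arcs of the curves in a state, outside the disc. -/
def Step (E : Exterior κ ι) (σ : E.V → Bool) :
    ((E.V × Bool) ⊕ E.W) ⊕ ι → ((E.V × Bool) ⊕ E.W) ⊕ ι → Prop :=
  Smoothing Sum.inl (fun x => E.wiring.symm (Sum.inl x)) σ

/-- The arcs outside the disc at its inputs and outputs. -/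
def ends (E : Exterior κ ι) : ι ⊕ ι → ((E.V × Bool) ⊕ E.W) ⊕ ι :=
  Sum.elim (fun i => E.wiring.symm (Sum.inr i)) Sum.inr

/-- The number of curves in a state, if the ends are connected by the pattern `p` in the disc. -/
noncomputable def loopsWith (E : Exterior κ ι) (σ : E.V → Bool) (p : ι ⊕ ι → ι ⊕ ι → Prop) : ℕ :=
  Nat.card (Quot (closeUp (E.Step σ) E.ends p))

variable [Fintype ι]

/-- Since the ends of the disc become points of the filled diagram, its smoothing relation is the
outer and the inner one glued along `ι ⊕ ι`, and the count for glued sets applies. -/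
theorem loopCount_fill (E : Exterior κ ι) (t : LocalTangle κ ι) (σ : E.V → Bool) (τ : t.V → Bool) :
    (E.fill t).loopCount (Sum.elim σ τ) = E.loopsWith σ (t.pattern τ) + t.closedLoops τ := by
  refine Eq.trans ?_ (card_quot_glueRel (E.Step σ) (t.Step τ) E.ends t.ends)
  have hq : ∀ x, Quot.mk (GlueRel (E.Step σ) (t.Step τ) E.ends t.ends)
      (sortStarts E.V t.V E.W ι ((E.fill t).next.symm x)) =
        Quot.mk _ (Sum.map E.wiring.symm t.wiring.symm (sortEnds E.V t.V E.W ι x)) := fun x =>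
    congrArg _ (Equiv.apply_symm_apply _ _)
  refine card_quot_congr (sortStarts E.V t.V E.W ι) ?_ ?_
  · rintro _ _ (⟨v | v, s, h⟩ | ⟨v | v, h⟩ | ⟨v | v, h⟩ | w | i | i)
    · exact (hq _).trans (Quot.sound (GlueRel.left (rX := E.Step σ) (Smoothing.oriented v s h)))
    · exact (hq _).trans (Quot.sound (GlueRel.right (rY := t.Step τ) (Smoothing.oriented v s h)))
    · exact (hq _).trans ((Quot.sound (GlueRel.left (rX := E.Step σ)
        (Smoothing.bottom v h))).trans (hq (Sum.inl (Sum.inl v, true))).symm)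
    · exact (hq _).trans ((Quot.sound (GlueRel.right (rY := t.Step τ)
        (Smoothing.bottom v h))).trans (hq (Sum.inl (Sum.inr v, true))).symm)
    · exact Quot.sound (GlueRel.left (rX := E.Step σ) (Smoothing.top v h))
    · exact Quot.sound (GlueRel.right (rY := t.Step τ) (Smoothing.top v h))
    · exact (hq _).trans (Quot.sound (GlueRel.left (rX := E.Step σ) (Smoothing.point w)))
    · exact (hq _).trans (Quot.sound (GlueRel.glue (f := E.ends) (g := t.ends) (Sum.inl i)))
    · exact (hq _).trans (Quot.sound (GlueRel.glue (f := E.ends) (g := t.ends) (Sum.inr i))).symm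
  · rintro _ _ ((⟨v, s, h⟩ | ⟨v, h⟩ | ⟨v, h⟩ | w) | (⟨v, s, h⟩ | ⟨v, h⟩ | ⟨v, h⟩ | w) | (i | i))
    · exact Quot.sound (.oriented (Sum.inl v) s h)
    · exact Quot.sound (.bottom (Sum.inl v) h)
    · exact Quot.sound (.top (Sum.inl v) h)
    · exact Quot.sound (Smoothing.point (V := E.V ⊕ t.V) (W := E.W ⊕ (ι ⊕ ι)) (Sum.inl w))
    · exact Quot.sound (.oriented (Sum.inr v) s h)
    · exact Quot.sound (.bottom (Sum.inr v) h)
    · exact Quot.sound (.top (Sum.inr v) h)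
    · exact w.elim
    · exact Quot.sound (Smoothing.point (V := E.V ⊕ t.V) (W := E.W ⊕ (ι ⊕ ι)) (Sum.inr (Sum.inl i)))
    · exact (Quot.sound
        (Smoothing.point (V := E.V ⊕ t.V) (W := E.W ⊕ (ι ⊕ ι)) (Sum.inr (Sum.inr i)))).symm

-- The cutting formula: the exterior enters only through the function of patterns to which the state
-- sum of the tangle is applied.
open Classical in
theorem stateSum_fill [Nonempty ι] (E : Exterior κ ι) (t : LocalTangle κ ι) (w : κ → Bool → K)
    (d : K) : (E.fill t).stateSum w d = ∑ σ : E.V → Bool, (∏ v, w (E.label v) (σ v)) *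
      t.stateSum w d fun p => d ^ (E.loopsWith σ p - 1) := by
  simp only [OrientedDiagram.stateSum, LocalTangle.stateSum, Finset.mul_sum]
  rw [← Fintype.sum_prod_type' (f := fun (σ : E.V → Bool) (τ : t.V → Bool) =>
    (∏ v, w (E.label v) (σ v)) * ((∏ v, w (t.label v) (τ v)) *
      (d ^ t.closedLoops τ * d ^ (E.loopsWith σ (t.pattern τ) - 1))))]
  let e : ((E.fill t).V → Bool) ≃ (E.V → Bool) × (t.V → Bool) :=
    Equiv.sumArrowEquivProdArrow E.V t.V Bool
  refine Fintype.sum_equiv e _ _ fun ρ => ?_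
  obtain ⟨⟨σ, τ⟩, rfl⟩ := e.symm.surjective ρ
  rw [Equiv.apply_symm_apply]
  -- The exponent is a truncated difference. Some curve meets the boundary of the disc, so the `- 1`
  -- can be charged to the curves with an outer part, and the closed curves inside keep their full
  -- power of `d`.
  have hpos : 0 < E.loopsWith σ (t.pattern τ) := by
    obtain ⟨i⟩ := ‹Nonempty ι›
    have : Nonempty (Quot (closeUp (E.Step σ) E.ends (t.pattern τ))) := ⟨Quot.mk _ (Sum.inr i)⟩
    exact Nat.card_pos
  have hprod : (∏ v : E.V ⊕ t.V, w ((E.fill t).label v) (e.symm (σ, τ) v)) =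
      (∏ v, w (E.label v) (σ v)) * ∏ v, w (t.label v) (τ v) := Fintype.prod_sum_type _
  have hloop : (E.fill t).loopCount (e.symm (σ, τ)) =
      E.loopsWith σ (t.pattern τ) + t.closedLoops τ := E.loopCount_fill t σ τ
  rw [hloop]
  refine Eq.trans (congrArg (· * _) hprod) ?_
  rw [show E.loopsWith σ (t.pattern τ) + t.closedLoops τ - 1 =
    t.closedLoops τ + (E.loopsWith σ (t.pattern τ) - 1) by omega, pow_add, mul_assoc]

/-- Tangles with equal state sums can replace each other. -/
theorem stateSum_fill_congr [Nonempty ι] (E : Exterior κ ι) {t t' : LocalTangle κ ι}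
    {w : κ → Bool → K} {d : K} (h : ∀ F, t.stateSum w d F = t'.stateSum w d F) :
    (E.fill t).stateSum w d = (E.fill t').stateSum w d := by
  classical
  simp only [stateSum_fill, h]

end Exterior

/-! ### Computation of state sums -/

/-- A list of the pairs in a smoothing relation. -/
def smoothingEdges {V W A : Type} (vs : List V) (ws : List W) (src tgt : (V × Bool) ⊕ W → A)
    (σ : V → Bool) : List (A × A) :=
  (vs.flatMap fun v => bif σ v
    then [(tgt (Sum.inl (v, false)), src (Sum.inl (v, false))),
      (tgt (Sum.inl (v, true)), src (Sum.inl (v, true)))]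
    else [(tgt (Sum.inl (v, false)), tgt (Sum.inl (v, true))),
      (src (Sum.inl (v, false)), src (Sum.inl (v, true)))]) ++
    ws.map fun w => (tgt (Sum.inr w), src (Sum.inr w))

theorem smoothing_iff_mem {V W A : Type} {vs : List V} (hvs : ∀ v, v ∈ vs) {ws : List W}
    (hws : ∀ w, w ∈ ws) (src tgt : (V × Bool) ⊕ W → A) (σ : V → Bool) (x y : A) :
    Smoothing src tgt σ x y ↔ (x, y) ∈ smoothingEdges vs ws src tgt σ := by
  rw [smoothingEdges, List.mem_append, List.mem_flatMap, List.mem_map]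
  constructor
  · rintro (⟨v, s, h⟩ | ⟨v, h⟩ | ⟨v, h⟩ | w)
    · exact Or.inl ⟨v, hvs v, by cases s <;> simp [h]⟩
    · exact Or.inl ⟨v, hvs v, by simp [h]⟩
    · exact Or.inl ⟨v, hvs v, by simp [h]⟩
    · exact Or.inr ⟨w, hws w, rfl⟩
  · rintro (⟨v, -, h⟩ | ⟨w, -, h⟩)
    · cases hv : σ v <;> simp only [hv, cond_true, cond_false, List.mem_cons, Prod.mk.injEq,
        List.not_mem_nil, or_false] at h <;> rcases h with ⟨rfl, rfl⟩ | ⟨rfl, rfl⟩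
      · exact .bottom v hv
      · exact .top v hv
      · exact .oriented v false hv
      · exact .oriented v true hv
    · rw [Prod.mk.injEq] at h
      obtain ⟨rfl, rfl⟩ := h
      exact .point w

/-- A numbering of the arcs. -/
def arcEquiv {V ι : Type} {k j : ℕ} (eV : V ≃ Fin k) (eι : ι ≃ Fin j) :
    (V × Bool) ⊕ ι ≃ Fin (k * 2 + j) :=
  (Equiv.sumCongr ((eV.prodCongr finTwoEquiv.symm).trans finProdFinEquiv) eι).trans finSumFinEquiv

/-- The number of closed curves inside the disc in a state of a tangle, and the list of those
ends of the tangle (by their positions) to which the ends are connected first. -/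
def tangleCode {V ι : Type} {k j : ℕ} (eV : V ≃ Fin k) (eι : ι ≃ Fin j)
    (wiring : (V × Bool) ⊕ ι ≃ (V × Bool) ⊕ ι) (σ : V → Bool) : ℕ × List ℕ :=
  let l := edgeLabels (arcEquiv eV eι) (smoothingEdges ((List.finRange k).map eV.symm) []
    (Sum.map id Empty.elim) (fun x => wiring.symm (Sum.map id Empty.elim x)) σ)
  let bl := (List.finRange (j + j)).map fun i => l.getD (arcEquiv eV eι (Sum.elim Sum.inr
    (fun i => wiring.symm (Sum.inr i))
    ((Sum.map eι.symm eι.symm : _ → ι ⊕ ι) (finSumFinEquiv.symm i)))) 0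
  ((l.dedup.filter fun x => !bl.contains x).length, bl.map fun x => bl.idxOf x)

namespace LocalTangle

variable {κ ι K : Type} [CommRing K] {k j : ℕ}

/-- The pattern of connections with a given list. -/
def decodePattern (eι : ι ≃ Fin j) (c : List ℕ) (s s' : ι ⊕ ι) : Prop :=
  c.getD (finSumFinEquiv (Sum.map eι eι s)) 0 = c.getD (finSumFinEquiv (Sum.map eι eι s')) 0

theorem step_iff_mem (t : LocalTangle κ ι) (eV : t.V ≃ Fin k) (τ : t.V → Bool)
    (x y : (t.V × Bool) ⊕ ι) : t.Step τ x y ↔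
      (x, y) ∈ smoothingEdges ((List.finRange k).map eV.symm) [] (Sum.map id Empty.elim)
        (fun x => t.wiring.symm (Sum.map id Empty.elim x)) τ :=
  smoothing_iff_mem (fun v => List.mem_map.2 ⟨eV v, List.mem_finRange _, eV.symm_apply_apply v⟩)
    (fun w => w.elim) _ _ _ _ _

theorem closedLoops_eq (t : LocalTangle κ ι) (eV : t.V ≃ Fin k) (eι : ι ≃ Fin j)
    (τ : t.V → Bool) : t.closedLoops τ = (tangleCode eV eι t.wiring τ).1 := by
  refine card_quot_avoiding (arcEquiv eV eι).bijective (t.step_iff_mem eV τ) _ _ fun x => ?_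
  rw [List.mem_map]
  constructor
  · rintro ⟨i, -, h⟩
    exact ⟨_, h⟩
  · rintro ⟨s, h⟩
    refine ⟨finSumFinEquiv (Sum.map eι eι s), List.mem_finRange _, ?_⟩
    rw [← h, Equiv.symm_apply_apply]
    cases s <;> simp [ends]

/-- Class labels are arbitrary, so each end is given the position of the first end in its class.
This normal form makes equal patterns have equal lists, and thus lets patterns of different tangles
be compared by evaluation. -/
theorem pattern_eq (t : LocalTangle κ ι) (eV : t.V ≃ Fin k) (eι : ι ≃ Fin j)
    (τ : t.V → Bool) :
    t.pattern τ = decodePattern eι (tangleCode eV eι t.wiring τ).2 := by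
  ext s s'
  refine (quot_mk_eq_iff_edgeLabels (arcEquiv eV eι).injective (t.step_iff_mem eV τ) _ _).trans ?_
  set l := edgeLabels (arcEquiv eV eι) (smoothingEdges ((List.finRange k).map eV.symm) []
    (Sum.map id Empty.elim) (fun x => t.wiring.symm (Sum.map id Empty.elim x)) τ) with hl
  set bl := (List.finRange (j + j)).map fun i => l.getD (arcEquiv eV eι (Sum.elim Sum.inr
    (fun i => t.wiring.symm (Sum.inr i))
    ((Sum.map eι.symm eι.symm : _ → ι ⊕ ι) (finSumFinEquiv.symm i)))) 0 with hbl
  have hmem : ∀ s, l.getD (arcEquiv eV eι (t.ends s)) 0 ∈ bl ∧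
      (bl.map fun x => bl.idxOf x).getD (finSumFinEquiv (Sum.map eι eι s)) 0 =
        bl.idxOf (l.getD (arcEquiv eV eι (t.ends s)) 0) := by
    intro s
    have h : ∀ hlt, bl[(finSumFinEquiv (Sum.map eι eι s) : ℕ)]'hlt =
        l.getD (arcEquiv eV eι (t.ends s)) 0 := by
      intro hlt
      simp only [hbl, List.getElem_map, List.getElem_finRange, Fin.cast_mk, Fin.eta,
        Equiv.symm_apply_apply]
      cases s <;> simp [ends]
    have hlt : (finSumFinEquiv (Sum.map eι eι s) : ℕ) < bl.length := by
      rw [hbl, List.length_map, List.length_finRange]; exact Fin.is_lt _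
    refine ⟨h hlt ▸ List.getElem_mem hlt, ?_⟩
    rw [List.getD_eq_getElem _ _ (by simpa using hlt), List.getElem_map, h hlt]
  change _ ↔ (bl.map fun x => bl.idxOf x).getD _ 0 = (bl.map fun x => bl.idxOf x).getD _ 0
  rw [(hmem s).2, (hmem s').2, List.idxOf_inj (hmem s).1]

theorem stateSum_mk {V : Type} [Fintype V] [DecidableEq V] (label : V → κ)
    (wiring : (V × Bool) ⊕ ι ≃ (V × Bool) ⊕ ι) (eV : V ≃ Fin k) (eι : ι ≃ Fin j)
    (w : κ → Bool → K) (d : K) (F : (ι ⊕ ι → ι ⊕ ι → Prop) → K) :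
    (LocalTangle.mk V label wiring).stateSum w d F =
      ∑ τ : V → Bool, (∏ v, w (label v) (τ v)) * (d ^ (tangleCode eV eι wiring τ).1 *
        F (decodePattern eι (tangleCode eV eι wiring τ).2)) := by
  refine Finset.sum_congr (by ext τ; simp only [Finset.mem_univ]) fun τ _ => ?_
  rw [closedLoops_eq ⟨V, label, wiring⟩ eV eι, pattern_eq ⟨V, label, wiring⟩ eV eι]

end LocalTangle

theorem sum_unit_arrow_bool {K : Type} [AddCommMonoid K] [Fintype (Unit → Bool)]
    (f : (Unit → Bool) → K) : ∑ σ, f σ = f (fun _ => true) + f fun _ => false := by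
  rw [Fintype.sum_equiv (Equiv.funUnique Unit Bool) f (fun b => f fun _ => b) fun σ =>
    congrArg f (funext fun _ => rfl), Fintype.sum_bool]

theorem sum_bool_arrow_bool {K : Type} [AddCommMonoid K] [Fintype (Bool → Bool)]
    (f : (Bool → Bool) → K) : ∑ σ, f σ =
      f (fun _ => true) + f (fun c => !c) + (f (fun c => c) + f fun _ => false) := by
  rw [Fintype.sum_equiv (Equiv.boolArrowEquivProd Bool) f
    (fun p => f fun c => bif c then p.2 else p.1) fun σ =>
      congrArg f (funext fun c => by cases c <;> rfl), Fintype.sum_prod_type, Fintype.sum_bool,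
    Fintype.sum_bool, Fintype.sum_bool]
  congr <;> ext c <;> cases c <;> rfl

/-- A sum over the states of three crossings, in which the values `c i` come first. -/
theorem sum_fin_three_arrow_bool {K : Type} [AddCommMonoid K] [Fintype (Fin 3 → Bool)]
    (f : (Fin 3 → Bool) → K) (c : Fin 3 → Bool) :
    ∑ σ, f σ = ∑ x : Bool, ∑ y : Bool, ∑ z : Bool, f fun i => ![x, y, z] i == c i := by
  let e : (Fin 3 → Bool) ≃ Bool × Bool × Bool :=
    { toFun := fun σ => (σ 0 == c 0, σ 1 == c 1, σ 2 == c 2)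
      invFun := fun p i => ![p.1, p.2.1, p.2.2] i == c i
      left_inv := fun σ => by ext i; fin_cases i <;> simp
      right_inv := fun ⟨x, y, z⟩ => by simp }
  rw [Fintype.sum_equiv e f (fun p => f (e.symm p)) fun σ => by rw [e.symm_apply_apply],
    Fintype.sum_prod_type]
  simp only [Fintype.sum_prod_type]
  rfl

/-! ### State sums of the tangles in the moves -/

section Moves

variable {K : Type} [CommRing K]

/-- The weights in the state sum of the Jones polynomial, where `A * B = 1`; a precrossing is
replaced by `X` times its smoothing. -/
def jonesWeight (A B X : K) : Option CrossingSign → Bool → K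
  | none, true => X
  | none, false => 0
  | some .pos, true => -B ^ 2
  | some .pos, false => -B ^ 4
  | some .neg, true => -A ^ 2
  | some .neg, false => -A ^ 4

namespace LocalTangle

variable {κ : Type}

theorem stateSum_trivial {ι : Type} {j : ℕ} (eι : ι ≃ Fin j) (w : κ → Bool → K) (d : K)
    (F : (ι ⊕ ι → ι ⊕ ι → Prop) → K) (c : List ℕ)
    (hc : tangleCode (V := Empty) finZeroEquiv.symm eι (Equiv.refl _) Empty.elim = (0, c)) :
    (LocalTangle.trivial κ ι).stateSum w d F = F (decodePattern eι c) := by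
  refine (stateSum_mk (V := Empty) Empty.elim (Equiv.refl _) finZeroEquiv.symm eι w d F).trans ?_
  have hc' : ∀ τ, tangleCode (V := Empty) finZeroEquiv.symm eι (Equiv.refl _) τ = (0, c) :=
    fun τ => Subsingleton.elim Empty.elim τ ▸ hc
  rw [Fintype.sum_unique, hc', Fintype.prod_empty, pow_zero, one_mul, one_mul]

/-- The oriented smoothing of a curl splits off a circle, and the other one leaves a plain strand.
-/
theorem stateSum_curl (s : Bool) (k : κ) (w : κ → Bool → K) (d : K)
    (F : (Unit ⊕ Unit → Unit ⊕ Unit → Prop) → K) :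
    (curl s k).stateSum w d F =
      (w k true * d + w k false) * (LocalTangle.trivial κ Unit).stateSum w d F := by
  -- The wiring does not depend on the labels, so codes are computed with labels in `Unit`.
  have h : ∀ s b, tangleCode (V := Unit) finOneEquiv.symm finOneEquiv.symm (curl s ()).wiring
      (fun _ => b) = (bif b then 1 else 0, [0, 0]) := by decide +kernel
  rw [stateSum_trivial finOneEquiv.symm w d F [0, 0] (by decide +kernel)]
  refine (stateSum_mk (V := Unit) (fun _ => k) (curl s ()).wiring finOneEquiv.symm finOneEquiv.symm
    w d F).trans ?_
  rw [sum_unit_arrow_bool, h, h, Fintype.prod_unique, Fintype.prod_unique, cond_true, cond_false]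
  ring

/-- The state sum of two parallel strands that cross twice, in terms of the two ways to connect
the four ends. -/
theorem stateSum_parallelBigon (k l : κ) (w : κ → Bool → K) (d : K)
    (F : (Bool ⊕ Bool → Bool ⊕ Bool → Prop) → K) :
    (parallelBigon k l).stateSum w d F =
      w k true * w l true * (LocalTangle.trivial κ Bool).stateSum w d F +
      (w k true * w l false + w k false * w l true + w k false * w l false * d) *
        F (decodePattern finTwoEquiv.symm [0, 0, 2, 2]) := by
  classical
  -- Ends are listed as the two inputs, then the two outputs: `[0, 1, 0, 1]` joins each input to its
  -- own output, and `[0, 0, 2, 2]` joins the inputs to each other and the outputs to each other.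
  have h : ∀ τ, tangleCode (V := Bool) finTwoEquiv.symm finTwoEquiv.symm
      (parallelBigon () ()).wiring τ =
      (bif τ false || τ true then 0 else 1, bif τ false && τ true then [0, 1, 0, 1] else [0, 0, 2, 2]) := by
    decide +kernel
  rw [stateSum_trivial finTwoEquiv.symm w d F [0, 1, 0, 1] (by decide +kernel)]
  refine (stateSum_mk (V := Bool) (fun c => if c then l else k) (parallelBigon () ()).wiring
    finTwoEquiv.symm finTwoEquiv.symm w d F).trans ?_
  simp only [sum_bool_arrow_bool, Fintype.prod_bool, h]
  simp only [Bool.or_true, Bool.or_false, Bool.and_true, Bool.and_false, cond_true, cond_false,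
    Bool.not_true, Bool.not_false, Bool.false_eq_true, if_true, if_false, pow_zero, pow_one]
  ring

/-- Compared with parallel strands the two smoothings exchange roles: two oriented smoothings close
up the bigon to a circle, and two unoriented ones restore the pattern of the uncrossed strands. In
`[0, 1, 1, 0]` each input is joined to the output of the other strand. -/
theorem stateSum_antiparallelBigon (s : Bool) (k l : κ) (w : κ → Bool → K) (d : K)
    (F : (Bool ⊕ Bool → Bool ⊕ Bool → Prop) → K) :
    (antiparallelBigon s k l).stateSum w d F =
      w k false * w l false * (LocalTangle.trivial κ Bool).stateSum w d F +
      (w k true * w l false + w k false * w l true + w k true * w l true * d) *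
        F (decodePattern finTwoEquiv.symm [0, 1, 1, 0]) := by
  classical
  have h : ∀ s τ, tangleCode (V := Bool) finTwoEquiv.symm finTwoEquiv.symm
      (antiparallelBigon s () ()).wiring τ =
      (bif τ false && τ true then 1 else 0, bif τ false || τ true then [0, 1, 1, 0] else [0, 1, 0, 1]) := by
    decide +kernel
  rw [stateSum_trivial finTwoEquiv.symm w d F [0, 1, 0, 1] (by decide +kernel)]
  refine (stateSum_mk (V := Bool) (fun c => if c then l else k) (antiparallelBigon s () ()).wiring
    finTwoEquiv.symm finTwoEquiv.symm w d F).trans ?_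
  simp only [sum_bool_arrow_bool, Fintype.prod_bool, h]
  simp only [Bool.or_true, Bool.or_false, Bool.and_true, Bool.and_false, cond_true, cond_false,
    Bool.not_true, Bool.not_false, Bool.false_eq_true, if_true, if_false, pow_zero, pow_one]
  ring

/-- The code of a state of a triangle; `t i` tells whether the smoothing of the crossing `i` cuts
the triangle off from the opposite region. -/
def triangleCode (f : Fin 3 → Bool) (m : Bool) (t : Fin 3 → Bool) : ℕ × List ℕ :=
  tangleCode (V := Fin 3) (Equiv.refl _) (Equiv.refl _) (triangle f m fun _ => ()).wiring
    fun i => t i == (f i == f (i + 1))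

/-- Pushing a strand across a crossing exchanges two patterns, with or without a closed curve, and
preserves the three others. -/
theorem triangleCode_eq : ∀ (f : Fin 3 → Bool) (m x y z : Bool),
    triangleCode f m ![x, y, z] =
      if (x && y && z) = true then (1, (triangleCode f (!m) ![false, false, false]).2)
      else if (x && y || x && z || y && z) = true then
        (0, (triangleCode f (!m) ![false, false, false]).2)
      else (0, (triangleCode f (m && !(x || y || z)) ![x, y, z]).2) := by
  decide +kernel

theorem stateSum_triangle (f : Fin 3 → Bool) (m : Bool) (label : Fin 3 → κ) (w : κ → Bool → K)
    (d : K) (F : (Fin 3 ⊕ Fin 3 → Fin 3 ⊕ Fin 3 → Prop) → K) :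
    (triangle f m label).stateSum w d F = ∑ x : Bool, ∑ y : Bool, ∑ z : Bool,
      (w (label 0) (x == (f 0 == f 1)) * w (label 1) (y == (f 1 == f 2)) *
        w (label 2) (z == (f 2 == f 0))) *
      (d ^ (triangleCode f m ![x, y, z]).1 *
        F (decodePattern (Equiv.refl _) (triangleCode f m ![x, y, z]).2)) := by
  refine (stateSum_mk (V := Fin 3) label (triangle f m fun _ => ()).wiring (Equiv.refl _)
    (Equiv.refl _) w d F).trans ?_
  -- States are indexed by which crossings cut off the triangle; at the crossing `i` this is done by
  -- the oriented smoothing exactly if `f i = f (i + 1)`.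
  rw [sum_fin_three_arrow_bool _ fun i => f i == f (i + 1)]
  simp only [Fin.prod_univ_three]
  rfl

end LocalTangle
end Moves

section Moves

variable {K : Type} [CommRing K]

namespace LocalTangle

/-- Here `x` and `y` are the weights of cutting off the triangle or not. States with exactly one cut
give the same pattern on both sides. The pattern without cuts on one side, with coefficient `y₀ * y₁
* y₂`, arises on the other side from the states with two or three cuts, the last with a circle. The
difference of the two sums is therefore the defect of `h` times a difference of two values of `F`.
-/
theorem stateSum_triangle_eq {κ : Type} (f : Fin 3 → Bool) (label : Fin 3 → κ)
    (w : κ → Bool → K) (d : K) (F : (Fin 3 ⊕ Fin 3 → Fin 3 ⊕ Fin 3 → Prop) → K)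
    {x₀ x₁ x₂ y₀ y₁ y₂ : K}
    (hx₀ : w (label 0) (f 0 == f 1) = x₀) (hx₁ : w (label 1) (f 1 == f 2) = x₁)
    (hx₂ : w (label 2) (f 2 == f 0) = x₂) (hy₀ : w (label 0) (!(f 0 == f 1)) = y₀)
    (hy₁ : w (label 1) (!(f 1 == f 2)) = y₁) (hy₂ : w (label 2) (!(f 2 == f 0)) = y₂)
    (h : x₀ * x₁ * x₂ * d + x₀ * x₁ * y₂ + x₀ * y₁ * x₂ + y₀ * x₁ * x₂ = y₀ * y₁ * y₂) :
    (triangle f false label).stateSum w d F = (triangle f true label).stateSum w d F := by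
  have key : ∀ m x y z, triangleCode f m ![x, y, z] = _ := triangleCode_eq f
  have h₁ := fun m => key m true true true
  have h₂ := fun m => key m true true false
  have h₃ := fun m => key m true false true
  have h₄ := fun m => key m false true true
  have h₅ := key true true false false
  have h₆ := key true false true false
  have h₇ := key true false false true
  have h₈ := fun m => key m false false false
  have h₅' := key false true false false
  have h₆' := key false false true false
  have h₇' := key false false false true
  simp only [Bool.and_true, Bool.and_false, Bool.or_true,
    Bool.or_false, Bool.not_true, Bool.not_false, if_true,
    if_false, Bool.false_eq_true] at h₁ h₂ h₃ h₄ h₅ h₆ h₇ h₈ h₅' h₆' h₇'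
  have e₈ : ∀ m, (triangleCode f m ![false, false, false]).1 = 0 := fun m => by rw [h₈]
  have e₅ : (triangleCode f false ![true, false, false]).1 = 0 := by rw [h₅']
  have e₆ : (triangleCode f false ![false, true, false]).1 = 0 := by rw [h₆']
  have e₇ : (triangleCode f false ![false, false, true]).1 = 0 := by rw [h₇']
  rw [stateSum_triangle, stateSum_triangle]
  simp only [Fintype.sum_bool, Bool.true_beq, Bool.false_beq, hx₀, hx₁, hx₂, hy₀, hy₁, hy₂,
    h₁, h₂, h₃, h₄, h₅, h₆, h₇, e₅, e₆, e₇, e₈, Bool.not_true, Bool.not_false, pow_zero, pow_one]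
  linear_combination h *
    (F (decodePattern (Equiv.refl _) (triangleCode f true ![false, false, false]).2) -
      F (decodePattern (Equiv.refl _) (triangleCode f false ![false, false, false]).2))

end LocalTangle

/-! ### Relations between the weights, and invariance under the moves -/

variable {A B X d : K}

/-- For a precrossing this is exactly `X * d = 1`; for classical crossings the writhe factor in the
weights makes it hold. -/
theorem jonesWeight_curl (hA : A * B = 1) (hd : d = -A ^ 2 - B ^ 2) (hX : X * d = 1)
    (k : Option CrossingSign) : jonesWeight A B X k true * d + jonesWeight A B X k false = 1 := by
  rcases k with _ | _ | _ <;> simp only [jonesWeight]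
  · rw [hX, add_zero]
  · rw [hd]; linear_combination (A * B + 1) * hA
  · rw [hd]; linear_combination (A * B + 1) * hA

/-- Both orientations of R2 are covered: the first part is used for the smoothing that restores the
strands when taken at both crossings, the second for the one that then bounds a circle. -/
theorem jonesWeight_bigon (hA : A * B = 1) (hd : d = -A ^ 2 - B ^ 2) {k l : CrossingSign}
    (h : k ≠ l) (b : Bool) :
    jonesWeight A B X (some k) b * jonesWeight A B X (some l) b = 1 ∧
    jonesWeight A B X (some k) true * jonesWeight A B X (some l) false +
      jonesWeight A B X (some k) false * jonesWeight A B X (some l) true +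
      jonesWeight A B X (some k) b * jonesWeight A B X (some l) b * d = 0 := by
  have h1 : jonesWeight A B X (some k) b * jonesWeight A B X (some l) b = 1 := by
    cases k <;> cases l <;> cases b <;> simp only [ne_eq, not_true_eq_false] at h <;>
      simp only [jonesWeight]
    · linear_combination (A * B + 1) * (A ^ 2 * B ^ 2 + 1) * hA
    · linear_combination (A * B + 1) * hA
    · linear_combination (A * B + 1) * (A ^ 2 * B ^ 2 + 1) * hA
    · linear_combination (A * B + 1) * hA
  refine ⟨h1, ?_⟩
  rw [h1, hd]
  cases k <;> cases l <;> simp only [ne_eq, not_true_eq_false] at h <;> simp only [jonesWeight]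
  · linear_combination (A * B + 1) * (A ^ 2 + B ^ 2) * hA
  · linear_combination (A * B + 1) * (A ^ 2 + B ^ 2) * hA

/-- At a crossing of a triangle, the weights of the smoothings that cut off the triangle or do not
depend on which strand runs over, up to a common factor. -/
theorem jonesWeight_triangleSign (hA : A * B = 1) (f o : Fin 3 → Bool) (i : Fin 3) :
    ∃ u, jonesWeight A B X (some (LocalTangle.triangleSign f o i)) (f i == f (i + 1)) =
        u * (if o i = true then A else B) ∧
      jonesWeight A B X (some (LocalTangle.triangleSign f o i)) (!(f i == f (i + 1))) =
        u * (if o i = true then B else A) := by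
  unfold LocalTangle.triangleSign
  cases o i <;> cases f i == f (i + 1) <;>
    simp only [Bool.false_eq_true, Bool.true_eq_false, if_true, if_false, jonesWeight,
      Bool.not_true, Bool.not_false]
  · exact ⟨-B ^ 3, by ring, by linear_combination B ^ 2 * hA⟩
  · exact ⟨-A ^ 3, by linear_combination A ^ 2 * hA, by ring⟩
  · exact ⟨-A ^ 3, by ring, by linear_combination A ^ 2 * hA⟩
  · exact ⟨-B ^ 3, by linear_combination B ^ 2 * hA, by ring⟩

namespace PseudoDiagram

open LocalTangle

/-- One strand runs over or under both crossings whose weights are written out, so these contribute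
opposite powers. The coefficient of `x` is then a multiple of `A * B * d + A ^ 2 + B ^ 2 = 0`, as in
R2, and the terms in `y` agree. As `x` and `y` are free, R3 and PR3 have the same proof. -/
theorem triangle_relation (hA : A * B = 1) (hd : d = -A ^ 2 - B ^ 2) {o o' : Bool} (h : o ≠ o')
    (x y u v : K) :
    x * (u * if o = true then A else B) * (v * if o' = true then A else B) * d +
      x * (u * if o = true then A else B) * (v * if o' = true then B else A) +
      x * (u * if o = true then B else A) * (v * if o' = true then A else B) +
      y * (u * if o = true then A else B) * (v * if o' = true then A else B) =
    y * (u * if o = true then B else A) * (v * if o' = true then B else A) := by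
  subst hd
  cases o <;> cases o' <;> simp only [ne_eq, not_true_eq_false] at h <;>
    simp only [Bool.false_eq_true, if_true, if_false] <;>
    linear_combination (-x * u * v * (A ^ 2 + B ^ 2)) * hA

theorem Move.stateSum_eq (hA : A * B = 1) (hd : d = -A ^ 2 - B ^ 2) (hX : X * d = 1)
    {P Q : PseudoDiagram} (h : Move P Q) :
    P.stateSum (jonesWeight A B X) d = Q.stateSum (jonesWeight A B X) d := by
  cases h with
  | isotopy h => exact h.stateSum_eq _ _
  | r1 E s k =>
    refine E.stateSum_fill_congr fun F => ?_
    rw [stateSum_curl, jonesWeight_curl hA hd hX, one_mul]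
  | r2_parallel E k l h =>
    refine E.stateSum_fill_congr fun F => ?_
    rw [stateSum_parallelBigon, (jonesWeight_bigon hA hd h false).2,
      (jonesWeight_bigon hA hd h true).1, one_mul, zero_mul, add_zero]
  | r2_antiparallel E s k l h =>
    refine E.stateSum_fill_congr fun F => ?_
    rw [stateSum_antiparallelBigon, (jonesWeight_bigon hA hd h true).2,
      (jonesWeight_bigon hA hd h false).1, one_mul, zero_mul, add_zero]
  | pr2_parallel E k =>
    refine E.stateSum_fill_congr fun F => ?_
    -- Both coefficients are symmetric in the two labels; no property of the weights is needed.
    rw [stateSum_parallelBigon, stateSum_parallelBigon]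
    ring
  | pr2_antiparallel E s k =>
    refine E.stateSum_fill_congr fun F => ?_
    rw [stateSum_antiparallelBigon, stateSum_antiparallelBigon]
    ring
  | r3 E f o h =>
    refine E.stateSum_fill_congr fun F => ?_
    obtain ⟨u₀, hx₀, hy₀⟩ := jonesWeight_triangleSign (X := X) hA f o 0
    obtain ⟨u₁, hx₁, hy₁⟩ := jonesWeight_triangleSign (X := X) hA f o 1
    obtain ⟨u₂, hx₂, hy₂⟩ := jonesWeight_triangleSign (X := X) hA f o 2
    refine stateSum_triangle_eq f _ _ _ F hx₀ hx₁ hx₂ hy₀ hy₁ hy₂ ?_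
    -- Two consecutive crossings with different values of `o` share a strand that is over or under
    -- both others: strand `2` if `o 1 ≠ o 2`, otherwise strand `1`.
    by_cases h₁₂ : o 1 = o 2
    · have h₀₁ : o 0 ≠ o 1 := fun h₀₁ => h ⟨h₀₁, h₁₂⟩
      linear_combination triangle_relation hA hd h₀₁ (u₂ * if o 2 = true then A else B)
        (u₂ * if o 2 = true then B else A) u₀ u₁
    · exact triangle_relation hA hd h₁₂ _ _ u₁ u₂
  | pr3 E f o h =>
    refine E.stateSum_fill_congr fun F => ?_
    obtain ⟨u₁, hx₁, hy₁⟩ := jonesWeight_triangleSign (X := X) hA f o 1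
    obtain ⟨u₂, hx₂, hy₂⟩ := jonesWeight_triangleSign (X := X) hA f o 2
    exact stateSum_triangle_eq f _ _ _ F rfl hx₁ hx₂ rfl hy₁ hy₂
      (triangle_relation hA hd h _ _ u₁ u₂)

theorem SamePseudolink.stateSum_eq (hA : A * B = 1) (hd : d = -A ^ 2 - B ^ 2) (hX : X * d = 1)
    {P Q : PseudoDiagram} (h : SamePseudolink P Q) :
    P.stateSum (jonesWeight A B X) d = Q.stateSum (jonesWeight A B X) d := by
  induction h with
  | rel _ _ h => exact h.2.2.stateSum_eq hA hd hX
  | refl => rfl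
  | symm _ _ _ ih => exact ih.symm
  | trans _ _ _ _ _ ih₁ ih₂ => exact ih₁.trans ih₂

end PseudoDiagram

end Moves

/-! ### Jones polynomials as state sums -/

namespace LinkDiagram

theorem loops_eq_loopCount (D : LinkDiagram) (σ : D.V → Bool) :
    D.loops σ = OrientedDiagram.loopCount D σ := by
  refine card_quot_congr (Equiv.refl _) ?_ ?_
  · rintro _ _ (⟨v, s, h⟩ | ⟨v, h⟩ | ⟨v, h⟩ | w)
    · exact Quot.sound (.oriented v s h)
    · exact Quot.sound (.bottom v h)
    · exact Quot.sound (.top v h)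
    · exact Quot.sound (.point w)
  · rintro _ _ (⟨v, s, h⟩ | ⟨v, h⟩ | ⟨v, h⟩ | w)
    · exact Quot.sound (.oriented v s h)
    · exact Quot.sound (.bottom v h)
    · exact Quot.sound (.top v h)
    · exact Quot.sound (.point w)

-- The factor `(-A ^ 3) ^ (-writhe)` is a product over crossings and is absorbed into the weights.
-- The value of `X` is arbitrary, as there are no precrossings.
open LaurentPolynomial in
theorem jones_eq_stateSum (D : LinkDiagram) (X : ℤ[T;T⁻¹]) :
    D.jones = OrientedDiagram.stateSum (fun k => jonesWeight (T 1) (T (-1)) X (some k)) delta D := by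
  classical
  have hw : ∀ k b, jonesWeight (T 1) (T (-1)) X (some k) b = (Int.negOnePow k.toInt : ℤ) •
      (T (-3 * k.toInt) * T (if b = true then k.toInt else -k.toInt) : ℤ[T;T⁻¹]) := by
    rintro (_ | _) (_ | _) <;>
      simp only [jonesWeight, CrossingSign.toInt, T_pow, ← T_add, Int.negOnePow_neg,
        Int.negOnePow_one, Units.val_neg, Units.val_one, neg_smul, one_smul, Bool.false_eq_true,
        if_true, if_false] <;> norm_num
  have key : ∀ (σ : D.V → Bool) (s : Finset D.V),
      (Int.negOnePow (∑ v ∈ s, (D.label v).toInt) : ℤ) •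
        (T (-3 * ∑ v ∈ s, (D.label v).toInt) *
          T (∑ v ∈ s, if σ v = true then (D.label v).toInt else -(D.label v).toInt) : ℤ[T;T⁻¹]) =
      ∏ v ∈ s, jonesWeight (T 1) (T (-1)) X (some (D.label v)) (σ v) := by
    intro σ s
    induction s using Finset.induction_on with
    | empty => simp
    | insert v s hv ih =>
      rw [Finset.prod_insert hv, ← ih, Finset.sum_insert hv, Finset.sum_insert hv, mul_add,
        Int.negOnePow_add, T_add, T_add, hw]
      simp only [zsmul_eq_mul, Units.val_mul, Int.cast_mul]
      ring
  rw [jones, bracket, Finset.mul_sum, Finset.smul_sum, OrientedDiagram.stateSum]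
  refine Finset.sum_congr rfl fun σ _ => ?_
  rw [← key σ Finset.univ, ← loops_eq_loopCount, ← mul_assoc, smul_mul_assoc]
  rfl

end LinkDiagram

namespace OrientedDiagram

variable {κ K : Type} [CommRing K]

theorem map_stateSum {K' : Type} [CommRing K'] (φ : K →+* K') (w : κ → Bool → K) (d : K)
    (D : OrientedDiagram κ) :
    φ (D.stateSum w d) = D.stateSum (fun k b => φ (w k b)) (φ d) := by
  simp only [stateSum, map_sum, map_mul, map_prod, map_pow]

theorem stateSum_of_isEmpty (D : OrientedDiagram κ) (h : IsEmpty D.V) (w : κ → Bool → K) (d : K) :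
    D.stateSum w d = d ^ (D.loopCount h.elim - 1) := by
  refine (Finset.sum_eq_single_of_mem h.elim (by simp only [Finset.mem_univ]) fun σ _ hσ =>
    (hσ (Subsingleton.elim _ _)).elim).trans ?_
  rw [Fintype.prod_empty, one_mul]

/-- The number of closed curves in a state. -/
def loopCode {V W : Type} {k j : ℕ} (eV : V ≃ Fin k) (eW : W ≃ Fin j)
    (next : (V × Bool) ⊕ W ≃ (V × Bool) ⊕ W) (σ : V → Bool) : ℕ :=
  (edgeLabels (arcEquiv eV eW) (smoothingEdges ((List.finRange k).map eV.symm)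
    ((List.finRange j).map eW.symm) id next.symm σ)).dedup.length

theorem loopCount_eq_loopCode {k j : ℕ} (D : OrientedDiagram κ) (eV : D.V ≃ Fin k)
    (eW : D.W ≃ Fin j) (σ : D.V → Bool) : D.loopCount σ = loopCode eV eW D.next σ :=
  card_quot_eq_length_dedup (arcEquiv eV eW).bijective (smoothing_iff_mem
    (fun v => List.mem_map.2 ⟨eV v, List.mem_finRange _, eV.symm_apply_apply v⟩)
    (fun w => List.mem_map.2 ⟨eW w, List.mem_finRange _, eW.symm_apply_apply w⟩) _ _ _)

theorem stateSum_mk {V W : Type} [Fintype V] [Fintype W] [DecidableEq V] {k j : ℕ}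
    (label : V → κ) (next : (V × Bool) ⊕ W ≃ (V × Bool) ⊕ W) (eV : V ≃ Fin k) (eW : W ≃ Fin j)
    (w : κ → Bool → K) (d : K) : (OrientedDiagram.mk V W label next).stateSum w d =
      ∑ σ : V → Bool, (∏ v, w (label v) (σ v)) * d ^ (loopCode eV eW next σ - 1) := by
  refine Finset.sum_congr (by ext τ; simp only [Finset.mem_univ]) fun σ _ => ?_
  rw [loopCount_eq_loopCode ⟨V, W, label, next⟩ eV eW]

end OrientedDiagram

/-! ### Precrossings in state sums, and values in the insertion ring -/

namespace PseudoDiagram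

variable {K : Type} [CommRing K]

/-- The two points that replace a precrossing join the same arcs as its oriented smoothing. -/
theorem loopCount_insertZeroTangle (P : PseudoDiagram) (σ : P.V → Bool)
    (hσ : ∀ v : P.Precrossing, σ v = true) :
    OrientedDiagram.loopCount P.insertZeroTangle (fun v => σ v.1) =
      OrientedDiagram.loopCount P σ := by
  let q := Quot.mk (Smoothing id P.insertZeroTangle.next.symm fun v => σ v.1)
  have hnext : ∀ x, P.splitPrecrossings (P.insertZeroTangle.next.symm x) =
      P.next.symm (P.splitPrecrossings x) := fun x => P.splitPrecrossings.apply_symm_apply _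
  have hnext' : ∀ x, q (P.splitPrecrossings.symm (P.next.symm (P.splitPrecrossings x))) =
      q (P.insertZeroTangle.next.symm x) := fun x => rfl
  have hsrc : ∀ x, q (P.splitPrecrossings.symm (P.splitPrecrossings x)) = q x := fun x =>
    congrArg q (P.splitPrecrossings.symm_apply_apply x)
  refine card_quot_congr P.splitPrecrossings ?_ ?_
  · rintro _ _ (⟨v, s, h⟩ | ⟨v, h⟩ | ⟨v, h⟩ | w | ⟨v, s⟩)
    · exact (congrArg _ (hnext _)).trans (Quot.sound (.oriented v.1 s h))
    · exact (congrArg _ (hnext _)).trans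
        ((Quot.sound (.bottom v.1 h)).trans (congrArg _ (hnext (Sum.inl (v, true)))).symm)
    · exact Quot.sound (.top v.1 h)
    · exact (congrArg _ (hnext _)).trans (Quot.sound (.point w))
    · exact (congrArg _ (hnext _)).trans (Quot.sound (.oriented v.1 s (hσ v)))
  · rintro _ _ (⟨v, s, h⟩ | ⟨v, h⟩ | ⟨v, h⟩ | w)
    · by_cases hv : (P.label v).isSome = true
      · exact (hnext' (Sum.inl (⟨v, hv⟩, s))).trans
          ((Quot.sound (.oriented (W := P.insertZeroTangle.W) (V := P.insertZeroTangle.V) ⟨v, hv⟩ s h)).trans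
            (hsrc (Sum.inl (⟨v, hv⟩, s))).symm)
      · exact (hnext' (Sum.inr (Sum.inr (⟨v, hv⟩, s)))).trans
          ((Quot.sound (.point (W := P.insertZeroTangle.W) (V := P.insertZeroTangle.V) (Sum.inr (⟨v, hv⟩, s)))).trans
            (hsrc (Sum.inr (Sum.inr (⟨v, hv⟩, s)))).symm)
    · have hv : (P.label v).isSome = true := by
        by_contra hv
        rw [hσ ⟨v, hv⟩] at h
        exact absurd h (by decide)
      exact (hnext' (Sum.inl (⟨v, hv⟩, false))).trans
        ((Quot.sound (.bottom (W := P.insertZeroTangle.W) (V := P.insertZeroTangle.V) ⟨v, hv⟩ h)).trans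
          (hnext' (Sum.inl (⟨v, hv⟩, true))).symm)
    · have hv : (P.label v).isSome = true := by
        by_contra hv
        rw [hσ ⟨v, hv⟩] at h
        exact absurd h (by decide)
      exact (hsrc (Sum.inl (⟨v, hv⟩, false))).trans
        ((Quot.sound (.top (W := P.insertZeroTangle.W) (V := P.insertZeroTangle.V) ⟨v, hv⟩ h)).trans
          (hsrc (Sum.inl (⟨v, hv⟩, true))).symm)
    · exact (hnext' (Sum.inr (Sum.inl w))).trans
        ((Quot.sound (.point (W := P.insertZeroTangle.W) (V := P.insertZeroTangle.V) (Sum.inl w))).trans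
          (hsrc (Sum.inr (Sum.inl w))).symm)

/-- The weight `0` kills every state with an unoriented smoothing at a precrossing. The others
correspond to states of the smoothed diagram, with one factor `w none true` per precrossing. -/
theorem stateSum_eq_insertZeroTangle (P : PseudoDiagram) (w : Option CrossingSign → Bool → K)
    (d : K) (hw : w none false = 0) : P.stateSum w d =
      w none true ^ Fintype.card P.Precrossing *
        OrientedDiagram.stateSum (fun k => w (some k)) d P.insertZeroTangle := by
  classical
  have hnone : ∀ v : P.Precrossing, P.label v.1 = none := fun v => by simpa using v.2
  let e : (P.V → Bool) ≃ (P.insertZeroTangle.V → Bool) × (P.Precrossing → Bool) :=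
    Equiv.piEquivPiSubtypeProd (fun v => (P.label v).isSome = true) fun _ => Bool
  rw [OrientedDiagram.stateSum, OrientedDiagram.stateSum, Finset.mul_sum,
    Fintype.sum_equiv e _ (fun p => (∏ v, w (P.label v) (e.symm p v)) *
      d ^ (OrientedDiagram.loopCount P (e.symm p) - 1)) fun σ => by rw [e.symm_apply_apply],
    Fintype.sum_prod_type]
  refine Finset.sum_congr rfl fun σ _ => ?_
  rw [Fintype.sum_eq_single (fun _ => true)]
  · have hpre : ∀ v : P.Precrossing, e.symm (σ, fun _ => true) v.1 = true := fun v =>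
      dif_neg v.2
    have hcl : ∀ v : P.insertZeroTangle.V, e.symm (σ, fun _ => true) v.1 = σ v := fun v =>
      dif_pos v.2
    rw [← loopCount_insertZeroTangle P _ hpre, ← mul_assoc]
    have hσ : (fun v : P.insertZeroTangle.V => e.symm (σ, fun _ => true) v.1) = σ := funext hcl
    have hprod : (∏ v : P.Precrossing, w (P.label v.1) (e.symm (σ, fun _ => true) v.1)) =
        w none true ^ Fintype.card P.Precrossing := by
      rw [← Finset.card_univ]
      exact Finset.prod_eq_pow_card fun v _ => by rw [hnone, hpre]
    have hprod' : (∏ v : P.ClassicalCrossing, w (P.label v.1) (e.symm (σ, fun _ => true) v.1)) =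
        ∏ v : P.insertZeroTangle.V, w (some (P.insertZeroTangle.label v)) (σ v) := by
      refine Finset.prod_congr rfl fun v _ => ?_
      rw [hcl v]
      exact congrArg (fun k => w k (σ v)) (Option.some_get v.2).symm
    rw [hσ, ← Fintype.prod_subtype_mul_prod_subtype (fun v => (P.label v).isSome = true), hprod,
      hprod']
    ring
  · intro τ hτ
    obtain ⟨v, hv⟩ := Function.ne_iff.1 hτ
    have hv' : e.symm (σ, τ) v.1 = false := (dif_neg v.2).trans (by simpa using hv)
    rw [Finset.prod_eq_zero (Finset.mem_univ v.1) (by rw [hnone v, hv', hw]), zero_mul]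

section

variable (I : LinkDiagram → ℤ[T;T⁻¹])

/-- The variable of the insertion ring. -/
noncomputable def insertionVar : InsertionRing I := Ideal.Quotient.mk _ Polynomial.X

/-- The inclusion of the coefficients. -/
noncomputable def insertionCoeff : ℤ[T;T⁻¹] →+* InsertionRing I :=
  (Ideal.Quotient.mk _).comp Polynomial.C

theorem insertionVar_mul : insertionVar I * insertionCoeff I (I LinkDiagram.twoCircles) = 1 := by
  rw [← sub_eq_zero, ← map_one (Ideal.Quotient.mk _)]
  change Ideal.Quotient.mk _ _ * Ideal.Quotient.mk _ _ - _ = _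
  rw [← map_mul, ← map_sub]
  exact Ideal.Quotient.eq_zero_iff_mem.2 (Ideal.subset_span rfl)

theorem tangleInsertion_eq (P : PseudoDiagram) : P.tangleInsertion I =
    insertionVar I ^ Fintype.card P.Precrossing * insertionCoeff I (I P.insertZeroTangle) := by
  rw [tangleInsertion, insertionPolynomial, map_mul, map_pow]
  rfl

end

open LaurentPolynomial in
theorem tangleInsertion_jones_eq_stateSum (P : PseudoDiagram) :
    P.tangleInsertion LinkDiagram.jones =
      P.stateSum (jonesWeight (insertionCoeff LinkDiagram.jones (T 1))
        (insertionCoeff LinkDiagram.jones (T (-1))) (insertionVar LinkDiagram.jones))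
        (insertionCoeff LinkDiagram.jones LinkDiagram.delta) := by
  rw [tangleInsertion_eq, stateSum_eq_insertZeroTangle _ _ _ rfl,
    LinkDiagram.jones_eq_stateSum P.insertZeroTangle 0, OrientedDiagram.map_stateSum]
  congr 2
  ext k b
  rcases k with _ | _ <;> cases b <;> simp only [jonesWeight, map_neg, map_pow]

theorem jones_twoCircles : LinkDiagram.twoCircles.jones = LinkDiagram.delta := by
  rw [LinkDiagram.jones_eq_stateSum _ 0]
  refine (OrientedDiagram.stateSum_mk (V := Empty) (W := Bool) Empty.elim (Equiv.refl _)
    finZeroEquiv.symm finTwoEquiv.symm _ _).trans ?_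
  have h : ∀ σ, OrientedDiagram.loopCode (V := Empty) (W := Bool) finZeroEquiv.symm
    finTwoEquiv.symm (Equiv.refl _) σ = 2 := by decide +kernel
  rw [Fintype.sum_unique, Fintype.prod_empty, h, one_mul, pow_one]

theorem SamePseudolink.tangleInsertion_jones_eq {P Q : PseudoDiagram} (h : P.SamePseudolink Q) :
    P.tangleInsertion LinkDiagram.jones = Q.tangleInsertion LinkDiagram.jones := by
  rw [tangleInsertion_jones_eq_stateSum, tangleInsertion_jones_eq_stateSum]
  refine h.stateSum_eq ?_ ?_ ?_
  · rw [← map_mul, ← LaurentPolynomial.T_add]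
    exact map_one _
  · rw [LinkDiagram.delta, map_sub, map_neg, ← map_pow, ← map_pow, LaurentPolynomial.T_pow,
      LaurentPolynomial.T_pow]
    norm_num
  · rw [← jones_twoCircles]
    exact insertionVar_mul _

end PseudoDiagram

/-! ### Faces, pieces and strands -/

namespace OrientedDiagram

variable {κ : Type} {k j : ℕ}

theorem mem_map_finRange {V : Type} (eV : V ≃ Fin k) (v : V) :
    v ∈ (List.finRange k).map eV.symm :=
  List.mem_map.2 ⟨eV v, List.mem_finRange _, eV.symm_apply_apply v⟩

/-- The pairs in the relation `SameFace`, apart from those at points. -/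
def faceEdges (D : OrientedDiagram κ) (vs : List D.V) : List ((D.Arc × Bool) × (D.Arc × Bool)) :=
  vs.flatMap fun v =>
    [((D.inArc v false, false), (D.outArc v false, false)),
      ((D.inArc v true, true), (D.outArc v true, true)),
      ((D.outArc v false, true), (D.outArc v true, false)),
      ((D.inArc v false, true), (D.inArc v true, false))]

/-- The pairs in the relation `Adjacent`, apart from those at points. -/
def adjacentEdges (D : OrientedDiagram κ) (vs : List D.V) : List (D.Arc × D.Arc) :=
  vs.flatMap fun v =>
    [(D.inArc v false, D.outArc v false), (D.inArc v true, D.outArc v true),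
      (D.inArc v false, D.inArc v true)]

/-- The pairs in the relation `SameStrand`. -/
def strandEdges (D : OrientedDiagram κ) (vs : List D.V) (ws : List D.W) : List (D.Arc × D.Arc) :=
  (vs.flatMap fun v => [(D.inArc v false, D.outArc v true), (D.inArc v true, D.outArc v false)]) ++
    ws.map fun w => (D.inPoint w, D.outPoint w)

theorem sameFace_iff_mem (D : OrientedDiagram κ) (eV : D.V ≃ Fin k) (hW : IsEmpty D.W)
    (x y : D.Arc × Bool) :
    D.SameFace x y ↔ (x, y) ∈ D.faceEdges ((List.finRange k).map eV.symm) := by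
  rw [faceEdges, List.mem_flatMap]
  constructor
  · rintro (v | v | v | v | w)
    · exact ⟨v, mem_map_finRange eV v, by simp⟩
    · exact ⟨v, mem_map_finRange eV v, by simp⟩
    · exact ⟨v, mem_map_finRange eV v, by simp⟩
    · exact ⟨v, mem_map_finRange eV v, by simp⟩
    · exact hW.elim w
  · rintro ⟨v, -, h⟩
    simp only [List.mem_cons, Prod.mk.injEq, List.not_mem_nil, or_false] at h
    obtain ⟨rfl, rfl⟩ | ⟨rfl, rfl⟩ | ⟨rfl, rfl⟩ | ⟨rfl, rfl⟩ :
        (x = (D.inArc v false, false) ∧ y = (D.outArc v false, false)) ∨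
        (x = (D.inArc v true, true) ∧ y = (D.outArc v true, true)) ∨
        (x = (D.outArc v false, true) ∧ y = (D.outArc v true, false)) ∨
        (x = (D.inArc v false, true) ∧ y = (D.inArc v true, false)) := by
      simpa only [Prod.ext_iff] using h
    exacts [.left v, .right v, .top v, .bottom v]

theorem adjacent_iff_mem (D : OrientedDiagram κ) (eV : D.V ≃ Fin k) (hW : IsEmpty D.W)
    (x y : D.Arc) :
    D.Adjacent x y ↔ (x, y) ∈ D.adjacentEdges ((List.finRange k).map eV.symm) := by
  rw [adjacentEdges, List.mem_flatMap]
  constructor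
  · rintro (⟨v, _ | _⟩ | v | w)
    · exact ⟨v, mem_map_finRange eV v, by simp⟩
    · exact ⟨v, mem_map_finRange eV v, by simp⟩
    · exact ⟨v, mem_map_finRange eV v, by simp⟩
    · exact hW.elim w
  · rintro ⟨v, -, h⟩
    simp only [List.mem_cons, Prod.mk.injEq, List.not_mem_nil, or_false] at h
    rcases h with ⟨rfl, rfl⟩ | ⟨rfl, rfl⟩ | ⟨rfl, rfl⟩
    exacts [.side v false, .side v true, .bottom v]

theorem sameStrand_iff_mem (D : OrientedDiagram κ) (eV : D.V ≃ Fin k) (eW : D.W ≃ Fin j)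
    (x y : D.Arc) : D.SameStrand x y ↔ (x, y) ∈ D.strandEdges ((List.finRange k).map eV.symm)
      ((List.finRange j).map eW.symm) := by
  rw [strandEdges, List.mem_append, List.mem_flatMap, List.mem_map]
  constructor
  · rintro (⟨v, _ | _⟩ | w)
    · exact Or.inl ⟨v, mem_map_finRange eV v, by simp⟩
    · exact Or.inl ⟨v, mem_map_finRange eV v, by simp⟩
    · exact Or.inr ⟨w, mem_map_finRange eW w, rfl⟩
  · rintro (⟨v, -, h⟩ | ⟨w, -, h⟩)
    · simp only [List.mem_cons, Prod.mk.injEq, List.not_mem_nil, or_false] at h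
      rcases h with ⟨rfl, rfl⟩ | ⟨rfl, rfl⟩
      exacts [.crossing v false, .crossing v true]
    · rw [Prod.mk.injEq] at h
      obtain ⟨rfl, rfl⟩ := h
      exact .point w

/-- Labels for the components of the link. -/
def strandLabels (D : OrientedDiagram κ) (eV : D.V ≃ Fin k) (eW : D.W ≃ Fin j) : List ℕ :=
  edgeLabels (arcEquiv eV eW) (D.strandEdges ((List.finRange k).map eV.symm)
    ((List.finRange j).map eW.symm))

/-- The label of the component of an arc. -/
def strandLabel (D : OrientedDiagram κ) (eV : D.V ≃ Fin k) (eW : D.W ≃ Fin j) (x : D.Arc) : ℕ :=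
  (D.strandLabels eV eW).getD (arcEquiv eV eW x) 0

theorem component_eq_iff (D : OrientedDiagram κ) (eV : D.V ≃ Fin k) (eW : D.W ≃ Fin j)
    (x y : D.Arc) : (Quot.mk _ x : D.Component) = Quot.mk _ y ↔
      D.strandLabel eV eW x = D.strandLabel eV eW y :=
  quot_mk_eq_iff_edgeLabels (arcEquiv eV eW).injective (D.sameStrand_iff_mem eV eW) x y

theorem card_component (D : OrientedDiagram κ) (eV : D.V ≃ Fin k) (eW : D.W ≃ Fin j) :
    Nat.card D.Component = (D.strandLabels eV eW).dedup.length :=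
  card_quot_eq_length_dedup (arcEquiv eV eW).bijective (D.sameStrand_iff_mem eV eW)

/-- Euler's formula for diagrams without points, in terms of labels. -/
theorem isPlanar_of_labels (D : OrientedDiagram κ) (eV : D.V ≃ Fin k) (eW : D.W ≃ Fin 0)
    (h : (edgeLabels (((arcEquiv eV eW).prodCongr finTwoEquiv.symm).trans finProdFinEquiv)
        (D.faceEdges ((List.finRange k).map eV.symm))).dedup.length =
      k + 2 * (edgeLabels (arcEquiv eV eW)
        (D.adjacentEdges ((List.finRange k).map eV.symm))).dedup.length) : D.IsPlanar := by
  have hW : IsEmpty D.W := eW.isEmpty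
  rw [IsPlanar, card_quot_eq_length_dedup (Equiv.bijective _) (D.sameFace_iff_mem eV hW), h,
    card_quot_eq_length_dedup (arcEquiv eV eW).bijective (D.adjacent_iff_mem eV hW),
    Fintype.card_congr eV, Fintype.card_fin]

/-- `subdivide`, with an algorithm that decides equality of arcs. -/
def subdivideWith (D : OrientedDiagram κ) [DecidableEq (D.Arc ⊕ Unit)] (a : D.Arc) :
    OrientedDiagram κ where
  V := D.V
  W := D.W ⊕ Unit
  label := D.label
  next := (Equiv.sumAssoc (D.V × Bool) D.W Unit).symm.trans
    (((Equiv.swap (Sum.inl a) (Sum.inr ())).trans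
      (Equiv.sumCongr D.next (Equiv.refl Unit))).trans
      (Equiv.sumAssoc (D.V × Bool) D.W Unit))

theorem subdivide_eq_subdivideWith (D : OrientedDiagram κ) [inst : DecidableEq (D.Arc ⊕ Unit)]
    (a : D.Arc) : D.subdivide a = D.subdivideWith a := by
  unfold subdivide subdivideWith
  congr!

end OrientedDiagram

namespace LinkDiagram

open OrientedDiagram

theorem mixedWrithe_eq {k j : ℕ} (D : LinkDiagram) (eV : D.V ≃ Fin k) (eW : D.W ≃ Fin j) :
    D.mixedWrithe = ∑ v, if strandLabel D eV eW (outArc D v false) =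
      strandLabel D eV eW (outArc D v true) then 0 else (D.label v).toInt := by
  classical
  refine Finset.sum_congr rfl fun v _ => ?_
  exact if_congr (component_eq_iff D eV eW _ _) rfl rfl

theorem linkingNumber_eq {k j : ℕ} (D : LinkDiagram) (eV : D.V ≃ Fin k) (eW : D.W ≃ Fin j)
    (x y : D.Arc) : D.linkingNumber (Quot.mk _ x) (Quot.mk _ y) = (1 / 2) *
      ((∑ v, if (strandLabel D eV eW (outArc D v false) = strandLabel D eV eW x ∧
          strandLabel D eV eW (outArc D v true) = strandLabel D eV eW y) ∨
        (strandLabel D eV eW (outArc D v false) = strandLabel D eV eW y ∧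
          strandLabel D eV eW (outArc D v true) = strandLabel D eV eW x)
        then (D.label v).toInt else 0 : ℤ) : ℚ) := by
  classical
  refine congrArg ((1 / 2 : ℚ) * ·) ?_
  rw [Int.cast_sum]
  refine Finset.sum_congr rfl fun v _ => ?_
  rw [Int.cast_ite, Int.cast_zero]
  exact if_congr (or_congr
    (and_congr (component_eq_iff D eV eW _ _) (component_eq_iff D eV eW _ _))
    (and_congr (component_eq_iff D eV eW _ _) (component_eq_iff D eV eW _ _))) rfl rfl

end LinkDiagram

/-! ### The examples -/

open OrientedDiagram in
theorem pseudoBorromean_isPlanar : pseudoBorromean.IsPlanar :=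
  isPlanar_of_labels pseudoBorromean (Equiv.refl (Fin 6)) finZeroEquiv.symm (by decide +kernel)

open OrientedDiagram in
theorem whiteheadLink_isPlanar : OrientedDiagram.IsPlanar whiteheadLink :=
  isPlanar_of_labels whiteheadLink (Equiv.refl (Fin 5)) finZeroEquiv.symm (by decide +kernel)

theorem card_component_whiteheadLink : Nat.card (OrientedDiagram.Component whiteheadLink) = 2 :=
  (OrientedDiagram.card_component whiteheadLink (Equiv.refl (Fin 5)) finZeroEquiv.symm).trans
    (by decide +kernel)

/-- Labels for the components of the Whitehead link. -/
def whiteheadStrand (x : (Fin 5 × Bool) ⊕ Empty) : ℕ :=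
  OrientedDiagram.strandLabel whiteheadLink (Equiv.refl (Fin 5)) finZeroEquiv.symm x

theorem linkingNumber_whiteheadLink (i j : OrientedDiagram.Component whiteheadLink) (hij : i ≠ j) :
    whiteheadLink.linkingNumber i j = 0 := by
  obtain ⟨x⟩ := i
  obtain ⟨y⟩ := j
  have key : ∀ x y : (Fin 5 × Bool) ⊕ Empty, whiteheadStrand x ≠ whiteheadStrand y →
      (∑ v : Fin 5, if (whiteheadStrand (Sum.inl (v, false)) = whiteheadStrand x ∧
          whiteheadStrand (Sum.inl (v, true)) = whiteheadStrand y) ∨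
        (whiteheadStrand (Sum.inl (v, false)) = whiteheadStrand y ∧
          whiteheadStrand (Sum.inl (v, true)) = whiteheadStrand x)
        then (whiteheadLink.label v).toInt else 0) = 0 := by decide +kernel
  have hxy : whiteheadStrand x ≠ whiteheadStrand y := fun h => hij
    ((OrientedDiagram.component_eq_iff whiteheadLink (Equiv.refl (Fin 5)) finZeroEquiv.symm x y).2 h)
  refine (LinkDiagram.linkingNumber_eq whiteheadLink (Equiv.refl (Fin 5)) finZeroEquiv.symm
    x y).trans ?_
  refine (congrArg (fun n : ℤ => (1 / 2 : ℚ) * n) (key x y hxy)).trans ?_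
  rw [Int.cast_zero, mul_zero]

/-- The crossings of the diagram obtained from the pseudo-Borromean diagram correspond to those of
the Whitehead link. -/
def borromeanCrossings : pseudoBorromean.insertZeroTangle.V ≃ Fin 5 where
  -- The entry at `0` is a dummy: that crossing is the precrossing.
  toFun v := (![0, 0, 2, 4, 1, 3] : Fin 6 → Fin 5) v.1
  invFun v := ⟨(![1, 4, 2, 5, 3] : Fin 5 → Fin 6) v, by revert v; decide⟩
  left_inv := by
    have : ∀ v : {v : Fin 6 // (pseudoBorromean.label v).isSome = true},
      (![1, 4, 2, 5, 3] : Fin 5 → Fin 6) ((![0, 0, 2, 4, 1, 3] : Fin 6 → Fin 5) v.1) = v.1 := by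
      decide
    exact fun v => Subtype.ext (this v)
  right_inv := by
    have : ∀ v, (![0, 0, 2, 4, 1, 3] : Fin 6 → Fin 5) ((![1, 4, 2, 5, 3] : Fin 5 → Fin 6) v) = v := by
      decide
    exact this

/-- The two points that replace the precrossing. -/
def borromeanPoints : pseudoBorromean.insertZeroTangle.W ≃ Fin 2 where
  toFun w := Sum.elim (fun e => e.elim) (fun p => if p.2 then 1 else 0) w
  invFun i := Sum.inr (⟨(0 : Fin 6), by decide⟩, ![false, true] i)
  left_inv := by
    have h : ∀ v : {v : Fin 6 // ¬ (pseudoBorromean.label v).isSome = true}, 0 = v.1 := by decide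
    have h' : ∀ s : Bool, (![false, true] : Fin 2 → Bool) (if s then 1 else 0) = s := by decide
    rintro (w | ⟨v, s⟩)
    · exact w.elim
    · exact congrArg Sum.inr (Prod.ext (Subtype.ext (h v)) (h' s))
  right_inv := by
    have : ∀ i : Fin 2, (if (![false, true] : Fin 2 → Bool) i then (1 : Fin 2) else 0) = i := by
      decide
    exact this

/-- Smoothing merges the first two rings, so their other crossing becomes a self-crossing; the four
crossings with the third ring have two signs of each kind. -/
theorem linkingInvariant_pseudoBorromean :
    pseudoBorromean.insertZeroTangle.linkingInvariant = 1 := by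
  have h : (∑ v : {v : Fin 6 // (pseudoBorromean.label v).isSome = true},
      if OrientedDiagram.strandLabel pseudoBorromean.insertZeroTangle borromeanCrossings
        borromeanPoints (Sum.inl (v, false)) =
        OrientedDiagram.strandLabel pseudoBorromean.insertZeroTangle borromeanCrossings
        borromeanPoints (Sum.inl (v, true)) then 0 else
      (pseudoBorromean.insertZeroTangle.label v).toInt) = 0 := by decide +kernel
  have hw : pseudoBorromean.insertZeroTangle.mixedWrithe = 0 :=
    (LinkDiagram.mixedWrithe_eq pseudoBorromean.insertZeroTangle borromeanCrossings
      borromeanPoints).trans h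
  rw [LinkDiagram.linkingInvariant, hw, LaurentPolynomial.T_zero]

theorem card_precrossing_pseudoBorromean : Fintype.card pseudoBorromean.Precrossing = 1 := by
  have h : Fintype.card {v : Fin 6 // ¬ (pseudoBorromean.label v).isSome = true} = 1 := by
    decide +kernel
  exact h

/-! ### The smoothed pseudo-Borromean diagram as a Whitehead link -/

instance : DecidableEq (OrientedDiagram.Arc whiteheadLink ⊕ Unit) :=
  inferInstanceAs (DecidableEq (((Fin 5 × Bool) ⊕ Empty) ⊕ Unit))

/-- The Whitehead link with one more point. -/
def whiteheadOnePoint : LinkDiagram :=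
  -- This arc comes from the one that enters the precrossing on the right.
  OrientedDiagram.subdivideWith whiteheadLink (Sum.inl ((2 : Fin 5), false))

instance : DecidableEq (OrientedDiagram.Arc whiteheadOnePoint ⊕ Unit) :=
  inferInstanceAs (DecidableEq (((Fin 5 × Bool) ⊕ (Empty ⊕ Unit)) ⊕ Unit))

/-- The Whitehead link with two more points. -/
def whiteheadTwoPoints : LinkDiagram :=
  -- This arc comes from the one that enters the precrossing on the left.
  OrientedDiagram.subdivideWith whiteheadOnePoint (Sum.inl ((4 : Fin 5), false))

/-- The left point of the precrossing, numbered `0`, is the one added last. -/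
def finTwoEquivPoints : Fin 2 ≃ (Empty ⊕ Unit) ⊕ Unit where
  toFun := ![Sum.inr (), Sum.inl (Sum.inr ())]
  invFun := Sum.elim (fun _ => 1) fun _ => 0
  left_inv := by decide
  right_inv := by decide

/-- Lets the finite types be written out explicitly for the instances, while the two maps are taken
from the goal up to unfolding. -/
theorem forall_eq_of_decide {S T : Type} [Fintype S] [DecidableEq T] (f g : S → T)
    (h : decide (∀ a, f a = g a) = true) : ∀ a, f a = g a := of_decide_eq_true h

/-- The diagram obtained from the pseudo-Borromean diagram, as a subdivided Whitehead link. -/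
def borromeanIso :
    OrientedDiagram.Iso pseudoBorromean.insertZeroTangle whiteheadTwoPoints where
  v := borromeanCrossings
  w := borromeanPoints.trans finTwoEquivPoints
  label_eq := by
    -- Signs are compared as integers, where equality is decidable.
    have h : ∀ x : {v : Fin 6 // (pseudoBorromean.label v).isSome = true},
        (whiteheadTwoPoints.label (borromeanCrossings x)).toInt =
          (pseudoBorromean.insertZeroTangle.label x).toInt := by decide +kernel
    have hinj : Function.Injective CrossingSign.toInt := by
      rintro (_ | _) (_ | _) h <;> first | rfl | exact absurd h (by decide)
    exact fun x => hinj (h x)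
  next_eq := by
    exact forall_eq_of_decide (S := ({v : Fin 6 // (pseudoBorromean.label v).isSome = true} × Bool) ⊕
        (Empty ⊕ ({v : Fin 6 // ¬ (pseudoBorromean.label v).isSome = true} × Bool)))
      (T := (Fin 5 × Bool) ⊕ ((Empty ⊕ Unit) ⊕ Unit)) _ _ (by decide +kernel)

theorem insertZeroTangle_pseudoBorromean_planarIsotopic :
    OrientedDiagram.PlanarIsotopic pseudoBorromean.insertZeroTangle whiteheadLink := by
  refine .trans _ _ _ (.rel _ _ (.iso borromeanIso)) (.symm _ _ (.trans _ whiteheadOnePoint _ ?_ ?_))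
  · rw [whiteheadOnePoint, ← OrientedDiagram.subdivide_eq_subdivideWith]
    exact .rel _ _ (.subdivide _ _)
  · rw [whiteheadTwoPoints, ← OrientedDiagram.subdivide_eq_subdivideWith]
    exact .rel _ _ (.subdivide _ _)

/-! ### The Jones polynomial of the Whitehead link -/

/-- The exponent and the number of closed curves of a state of the Whitehead link. -/
def whiteheadCode (σ : Fin 5 → Bool) : ℤ × ℕ :=
  (∑ v : Fin 5, if σ v = true then (whiteheadLink.label v).toInt else -(whiteheadLink.label v).toInt,
    OrientedDiagram.loopCode (V := Fin 5) (W := Empty) (Equiv.refl _) finZeroEquiv.symm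
      whiteheadLink.next σ)

/-- The exponents have binomial multiplicities `1, 5, 10, 10, 5, 1`. Only exponent `1` splits by the
number of curves: eight states with one curve, two with three. -/
theorem whiteheadCode_states : Finset.univ.val.map whiteheadCode =
    ↑([(-5, 4)] ++ (List.replicate 5 (-3, 3) ++ (List.replicate 10 (-1, 2) ++ (List.replicate 8 (1, 1) ++
      (List.replicate 2 (1, 3) ++ (List.replicate 5 (3, 2) ++ [(5, 3)]))))) : List (ℤ × ℕ)) := by
  decide +kernel

open LaurentPolynomial in
theorem bracket_whiteheadLink : whiteheadLink.bracket =
    T (-5) * LinkDiagram.delta ^ 3 + 5 * (T (-3) * LinkDiagram.delta ^ 2) +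
      10 * (T (-1) * LinkDiagram.delta) + 8 * T 1 + 2 * (T 1 * LinkDiagram.delta ^ 2) +
      5 * (T 3 * LinkDiagram.delta) + T 5 * LinkDiagram.delta ^ 2 := by
  have h : whiteheadLink.bracket = ((Finset.univ.val.map whiteheadCode).map fun c =>
      (T c.1 * LinkDiagram.delta ^ (c.2 - 1) : ℤ[T;T⁻¹])).sum := by
    rw [Multiset.map_map]
    refine Finset.sum_congr (Finset.ext fun σ => ⟨fun _ => Finset.mem_univ (α := Fin 5 → Bool) σ,
      fun _ => by simp only [Finset.mem_univ]⟩) fun σ _ => ?_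
    rw [LinkDiagram.loops_eq_loopCount, OrientedDiagram.loopCount_eq_loopCode whiteheadLink
      (Equiv.refl (Fin 5)) finZeroEquiv.symm]
    rfl
  rw [h, whiteheadCode_states, Multiset.map_coe, Multiset.sum_coe]
  simp only [List.map_append, List.sum_append, List.map_replicate, List.sum_replicate, List.map_cons,
    List.map_nil, List.sum_cons, List.sum_nil, Nat.reduceSub, pow_zero, pow_one, mul_one, add_zero,
    nsmul_eq_mul, Nat.cast_ofNat]
  ring

open LaurentPolynomial in
theorem jones_whiteheadLink : whiteheadLink.jones = whiteheadPolynomial := by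
  have hw : whiteheadLink.writhe = 1 := by
    have : (∑ v : Fin 5, (whiteheadLink.label v).toInt) = 1 := by decide +kernel
    exact this
  rw [LinkDiagram.jones, hw, bracket_whiteheadLink, whiteheadPolynomial, LinkDiagram.delta,
    Int.negOnePow_one, Units.val_neg, Units.val_one, neg_smul, one_smul]
  simp only [pow_succ, pow_zero, one_mul, mul_sub, sub_mul, mul_neg, neg_mul, mul_add,
    mul_left_comm _ (OfNat.ofNat _ : ℤ[T;T⁻¹]), ← T_add]
  norm_num
  ring

/-! ### Nontriviality -/

section Evaluation

open LaurentPolynomial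

theorem eval_delta (u : ℚˣ) :
    eval₂ (Int.castRingHom ℚ) u LinkDiagram.delta = -(u : ℚ) ^ 2 - ((u : ℚ)⁻¹) ^ 2 := by
  rw [LinkDiagram.delta, map_sub, map_neg, eval₂_T, eval₂_T]
  simp [zpow_neg]

theorem eval_whiteheadPolynomial (u : ℚˣ) :
    eval₂ (Int.castRingHom ℚ) u whiteheadPolynomial = -(u : ℚ) ^ 6 + (u : ℚ) ^ 2 -
      2 * (u : ℚ)⁻¹ ^ 2 + (u : ℚ)⁻¹ ^ 6 - 2 * (u : ℚ)⁻¹ ^ 10 + (u : ℚ)⁻¹ ^ 14 := by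
  simp only [whiteheadPolynomial, map_add, map_sub, map_neg, map_mul, map_ofNat, eval₂_T]
  simp [zpow_neg]

/-- A number `u` with `δ ≠ 0` defines an evaluation of the values of the tangle insertion
invariant. -/
theorem exists_eval (u : ℚˣ) (hu : eval₂ (Int.castRingHom ℚ) u LinkDiagram.delta ≠ 0) :
    ∃ φ : PseudoDiagram.InsertionRing LinkDiagram.jones →+* ℚ,
      φ (PseudoDiagram.insertionVar LinkDiagram.jones) =
        (eval₂ (Int.castRingHom ℚ) u LinkDiagram.delta)⁻¹ ∧
      ∀ p, φ (PseudoDiagram.insertionCoeff LinkDiagram.jones p) =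
        eval₂ (Int.castRingHom ℚ) u p := by
  -- Sending `X` to the inverse of the value of `δ` kills the relation of the insertion ring.
  let ψ : Polynomial ℤ[T;T⁻¹] →+* ℚ := Polynomial.eval₂RingHom (eval₂ (Int.castRingHom ℚ) u)
    (eval₂ (Int.castRingHom ℚ) u LinkDiagram.delta)⁻¹
  have hψ : Ideal.span {Polynomial.X * Polynomial.C (LinkDiagram.jones LinkDiagram.twoCircles) - 1} ≤
      RingHom.ker ψ := by
    rw [Ideal.span_singleton_le_iff_mem, RingHom.mem_ker, PseudoDiagram.jones_twoCircles]
    simp [ψ, hu]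
  refine ⟨Ideal.Quotient.lift _ ψ fun p hp => hψ hp, ?_, fun p => ?_⟩
  · exact (Ideal.Quotient.lift_mk _ _ _).trans (by simp [ψ])
  · exact (Ideal.Quotient.lift_mk _ _ _).trans (by simp [ψ])

end Evaluation

theorem tangleInsertion_jones_pseudoBorromean :
    pseudoBorromean.tangleInsertion LinkDiagram.jones =
      Ideal.Quotient.mk _ (Polynomial.X * Polynomial.C whiteheadPolynomial) := by
  have h : pseudoBorromean.insertZeroTangle.jones = whiteheadPolynomial := by
    rw [← jones_whiteheadLink, LinkDiagram.jones_eq_stateSum _ 0,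
      LinkDiagram.jones_eq_stateSum whiteheadLink 0,
      insertZeroTangle_pseudoBorromean_planarIsotopic.stateSum_eq]
  rw [PseudoDiagram.tangleInsertion, PseudoDiagram.insertionPolynomial,
    card_precrossing_pseudoBorromean, pow_one, h]

/-- The number of circles in `U` is unknown, so the unknown power of `δ` is eliminated by comparing
two points at which `δ` takes the same value. -/
theorem tangleInsertion_jones_pseudoBorromean_ne {U : PseudoDiagram} (hU : U.IsTrivial) :
    pseudoBorromean.tangleInsertion LinkDiagram.jones ≠ U.tangleInsertion LinkDiagram.jones := by
  intro h
  rw [tangleInsertion_jones_pseudoBorromean, PseudoDiagram.tangleInsertion_jones_eq_stateSum U,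
    OrientedDiagram.stateSum_of_isEmpty U hU, map_mul] at h
  have key : ∀ u : ℚˣ, LaurentPolynomial.eval₂ (Int.castRingHom ℚ) u LinkDiagram.delta ≠ 0 →
      (LaurentPolynomial.eval₂ (Int.castRingHom ℚ) u LinkDiagram.delta)⁻¹ *
        LaurentPolynomial.eval₂ (Int.castRingHom ℚ) u whiteheadPolynomial =
      LaurentPolynomial.eval₂ (Int.castRingHom ℚ) u LinkDiagram.delta ^
        (OrientedDiagram.loopCount U hU.elim - 1) := by
    intro u hu
    obtain ⟨φ, hX, hC⟩ := exists_eval u hu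
    have := congrArg φ h
    rw [map_mul, map_pow, hC] at this
    rw [← hX, ← hC whiteheadPolynomial]
    exact this
  -- The points `A = 2` and `A = 1/2` are exchanged by `A ↔ A⁻¹`, which fixes `δ` but not `V`.
  have h₁ := key (Units.mk0 2 two_ne_zero) (by rw [eval_delta]; norm_num)
  have h₂ := key (Units.mk0 2⁻¹ (by norm_num)) (by rw [eval_delta]; norm_num)
  simp only [eval_delta, eval_whiteheadPolynomial, Units.val_mk0, inv_inv] at h₁ h₂
  rw [show (-(2⁻¹ : ℚ) ^ 2 - 2 ^ 2) = -2 ^ 2 - 2⁻¹ ^ 2 by norm_num, ← h₁] at h₂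
  norm_num at h₂

/-- Two disjoint circles have total linking number `0`, so the relation forces `X = 1`, and both
sides reduce to `q ^ 0`. -/
theorem tangleInsertion_linkingInvariant_eq {U : PseudoDiagram} (hU : U.IsTrivial) :
    pseudoBorromean.tangleInsertion LinkDiagram.linkingInvariant =
      U.tangleInsertion LinkDiagram.linkingInvariant := by
  have h : ∀ D : LinkDiagram, IsEmpty D.V → D.linkingInvariant = 1 := fun D hD => by
    rw [LinkDiagram.linkingInvariant, LinkDiagram.mixedWrithe]
    simp
  have hX := PseudoDiagram.insertionVar_mul LinkDiagram.linkingInvariant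
  have hone : PseudoDiagram.insertionCoeff LinkDiagram.linkingInvariant
      LinkDiagram.twoCircles.linkingInvariant = 1 :=
    (congrArg _ (h _ (inferInstanceAs (IsEmpty Empty)))).trans (map_one _)
  rw [hone, mul_one] at hX
  rw [PseudoDiagram.tangleInsertion_eq, PseudoDiagram.tangleInsertion_eq, hX, one_pow, one_pow,
    linkingInvariant_pseudoBorromean, h U.insertZeroTangle ⟨fun v => hU.elim v.1⟩]

theorem mainTheorem5 :
    -- both diagrams are planar, and inserting the 0-tangle produces the Whitehead link
    pseudoBorromean.IsPlanar ∧ whiteheadLink.IsPlanar ∧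
    OrientedDiagram.PlanarIsotopic pseudoBorromean.insertZeroTangle whiteheadLink ∧
    -- the Jones polynomial of the Whitehead link
    whiteheadLink.jones = whiteheadPolynomial ∧
    -- the value of the tangle insertion invariant, as `X * V` with `X = 1 / δ`
    pseudoBorromean.tangleInsertion LinkDiagram.jones =
      Ideal.Quotient.mk _ (Polynomial.X * Polynomial.C whiteheadPolynomial) ∧
    LinkDiagram.twoCircles.jones = LinkDiagram.delta ∧
    -- it is an invariant of pseudolinks, which shows that the pseudolink is nontrivial
    (∀ P Q : PseudoDiagram, P.SamePseudolink Q →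
      P.tangleInsertion LinkDiagram.jones = Q.tangleInsertion LinkDiagram.jones) ∧
    (∀ U : PseudoDiagram, U.IsTrivial →
      pseudoBorromean.tangleInsertion LinkDiagram.jones ≠ U.tangleInsertion LinkDiagram.jones ∧
      ¬ pseudoBorromean.SamePseudolink U) ∧
    -- the linking number of the Whitehead link is zero, and the invariant that is built in the
    -- same way from the linking number does not detect the nontriviality
    Nat.card whiteheadLink.Component = 2 ∧
    (∀ i j : whiteheadLink.Component, i ≠ j → whiteheadLink.linkingNumber i j = 0) ∧
    (∀ U : PseudoDiagram, U.IsTrivial →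
      pseudoBorromean.tangleInsertion LinkDiagram.linkingInvariant =
        U.tangleInsertion LinkDiagram.linkingInvariant) := by
  refine ⟨pseudoBorromean_isPlanar, whiteheadLink_isPlanar,
    insertZeroTangle_pseudoBorromean_planarIsotopic, jones_whiteheadLink,
    tangleInsertion_jones_pseudoBorromean, PseudoDiagram.jones_twoCircles,
    fun P Q h => h.tangleInsertion_jones_eq, fun U hU => ⟨?_, fun h => ?_⟩,
    card_component_whiteheadLink, linkingNumber_whiteheadLink,
    fun U hU => tangleInsertion_linkingInvariant_eq hU⟩
  · exact tangleInsertion_jones_pseudoBorromean_ne hU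
  · exact tangleInsertion_jones_pseudoBorromean_ne hU h.tangleInsertion_jones_eq
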